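/- The regions below lie on the triangular lattice of unit equilateral triangles that has one family of horizontal lattice lines. A lozenge is the union of two unit triangles that share an edge. For a lattice region $R$ (a finite union of unit triangles), $\operatorname{M}(R)$ denotes the number of lozenge tilings of $R$, that is, of sets of lozenges with pairwise disjoint interiors whose union is $R$ (so $\operatorname{M}(\emptyset)=1$). For a nonnegative integer $n$ let $\operatorname{H}(n)=0!\,1!\cdots(n-1)!$, with $\operatorname{H}(0)=1$. Let $x,y,a,b,c,m$ be nonnegative integers. The magnet bar region $B_{x,y}(a,b,c,m)$ is obtained from the (possibly degenerate) lattice hexagon with angles $120^\circ$ whose side lengths, clockwise from the horizontal top side, are $x+c,\ y+m,\ a+b+c,\ x+m,\ y+c,\ a+b+m$ by removing two equilateral triangles. The first is the up-pointing triangle of side $m$ that has its left side on the northwestern side of the hexagon, so that the portions of that side above and below the triangle have lengths $a$ and $b$, respectively. The second is the down-pointing triangle of side $c$ whose upper left vertex is the lower right vertex of the triangle of side $m$. **Theorem 3.1.** For any nonnegative integers $x,y,a,b,c,m$, $$ \begin{aligned} \operatorname{M}(B_{x,y}(a,b,c,m))={}&\frac{\operatorname{H}(m)^2\operatorname{H}(a)\operatorname{H}(b)\operatorname{H}(c)\operatorname{H}(m+a+b+c)}{\operatorname{H}(m+a)\operatorname{H}(m+b)\operatorname{H}(m+c)}\\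 &\times\frac{\operatorname{H}(x+m+a+c)\operatorname{H}(y+m+b+c)}{\operatorname{H}(x+y+m+c)}\cdot\frac{\operatorname{H}(x+y+c)}{\operatorname{H}(x+a+c)\operatorname{H}(y+b+c)}\\ &\times\frac{\operatorname{H}(x+y+m+a+b+c)}{\operatorname{H}(x+m+a+b+c)\operatorname{H}(y+m+a+b+c)}\cdot\frac{\operatorname{H}(x)\operatorname{H}(y)}{\operatorname{H}(x+y)}. \end{aligned} $$ -/

import Mathlib

open Finset

/-- A unit triangle of the triangular lattice. Lattice points are written `(i, j) : ℤ × ℤ` and stand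
for `i • e₁ + j • e₂`, with `e₁` the unit vector pointing east and `e₂` the unit vector at `60°`
above it. The triangle is the up-pointing or the down-pointing half of the rhombus with
vertices `(i, j)`, `(i + 1, j)`, `(i, j + 1)`, `(i + 1, j + 1)`. -/
@[ext] structure UnitTriangle where
  i : ℤ
  j : ℤ
  up : Bool
deriving DecidableEq

namespace UnitTriangle

/-- The three vertices of a unit triangle. -/
def vertices (t : UnitTriangle) : Finset (ℤ × ℤ) :=
  if t.up then {(t.i, t.j), (t.i + 1, t.j), (t.i, t.j + 1)}
  else {(t.i + 1, t.j), (t.i, t.j + 1), (t.i + 1, t.j + 1)}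

/-- Two different unit triangles are adjacent if they share an edge, that is, two vertices. -/
def Adj (s t : UnitTriangle) : Prop := s ≠ t ∧ #(s.vertices ∩ t.vertices) = 2

/-- The unit triangle lies in the closed convex lattice polygon whose set of lattice points
is `P`. -/
def In (t : UnitTriangle) (P : Set (ℤ × ℤ)) : Prop := ∀ p ∈ t.vertices, p ∈ P

end UnitTriangle

/-- A lozenge is the union of two adjacent unit triangles. -/
def IsLozenge (L : Finset UnitTriangle) : Prop :=
  ∃ s t : UnitTriangle, s.Adj t ∧ L = {s, t}

/-- `T` is a lozenge tiling of the region `R` (a set of unit triangles): a set of pairwise disjoint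
lozenges whose union is `R`. -/
structure IsLozengeTiling (R : Set UnitTriangle) (T : Set (Finset UnitTriangle)) : Prop where
  lozenge : ∀ L ∈ T, IsLozenge L
  disjoint : T.PairwiseDisjoint id
  cover : ∀ t : UnitTriangle, t ∈ R ↔ ∃ L ∈ T, t ∈ L

/-- The number of lozenge tilings of `R`. -/
noncomputable def numLozengeTilings (R : Set UnitTriangle) : ℕ :=
  {T : Set (Finset UnitTriangle) | IsLozengeTiling R T}.ncard

/-- Lattice points of the up-pointing triangle of side `n` whose lower left vertex is `p`; its other
vertices are `p + (n, 0)` and `p + (0, n)`. -/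
def upTriangle (p : ℤ × ℤ) (n : ℕ) : Set (ℤ × ℤ) :=
  {q | p.1 ≤ q.1 ∧ p.2 ≤ q.2 ∧ q.1 + q.2 ≤ p.1 + p.2 + n}

/-- Lattice points of the down-pointing triangle of side `n` whose upper left vertex is `p`; its
other vertices are `p + (n, 0)` and `p + (n, -n)`. -/
def downTriangle (p : ℤ × ℤ) (n : ℕ) : Set (ℤ × ℤ) :=
  {q | q.1 ≤ p.1 + n ∧ q.2 ≤ p.2 ∧ p.1 + p.2 ≤ q.1 + q.2}

/-- Lattice points of the hexagon with western vertex `(0, 0)` whose sides, clockwise from the top,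
have lengths `x + c`, `y + m`, `a + b + c`, `x + m`, `y + c`, `a + b + m`. Its vertices, clockwise
from the western one, are `(0, 0)`, `(0, a + b + m)`, `(x + c, a + b + m)`,
`(x + y + c + m, a + b - y)`, `(x + y + c + m, -(y + c))`, `(y + c, -(y + c))`. -/
def outerHexagon (x y a b c m : ℕ) : Set (ℤ × ℤ) :=
  {q | 0 ≤ q.1 ∧ q.1 ≤ x + y + c + m ∧ -(y + c : ℤ) ≤ q.2 ∧ q.2 ≤ a + b + m ∧
    0 ≤ q.1 + q.2 ∧ q.1 + q.2 ≤ x + c + a + b + m}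

/-- The magnet bar region `B_{x,y}(a,b,c,m)`. From the hexagon one removes the up-pointing triangle
of side `m` that has one side on the northwestern side of the hexagon, leaving a segment of length
`b` of that side below it and one of length `a` above it, and the down-pointing triangle of side
`c` whose upper left vertex is the lower right vertex `(m, b)` of the triangle of side `m`. -/
def magnetBarRegion (x y a b c m : ℕ) : Set UnitTriangle :=
  {t | t.In (outerHexagon x y a b c m) ∧ ¬ t.In (upTriangle (0, (b : ℤ)) m) ∧
    ¬ t.In (downTriangle ((m : ℤ), (b : ℤ)) c)}

/-- The hyperfactorial `H(n) = 0! 1! ⋯ (n-1)!`. -/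
def hyperfactorial (n : ℕ) : ℕ := ∏ k ∈ range n, k.factorial

/-! Slice the region along the lattice lines `i + j = k`. The unit edges on these lines that are not
crossed by a lozenge are linked by the remaining lozenges into nonintersecting lattice paths, each
step moving the first coordinate by 0 or 1, and these paths determine the tiling
(`numLozengeTilings_eq_ncard_crossingSets`).

The line `i + j = b + m` contains the right side of the up-pointing hole and the left side of the
down-pointing one. Of the `y + c` paths that start on the southwestern side, `c` end on the
down-pointing hole. The other `y` cross the line at a set `Q` to the right of both holes, and `m`
new paths start on the up-pointing hole. So the count is a sum over `Q` of a product of two path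
counts (`numLozengeTilings_magnetBarRegion_eq_sum`).

In each factor one of the two end sets is an interval, so the Lindström–Gessel–Viennot determinant
(`pathCount_eq_det`) reduces to a Vandermonde product times a weight for each position
(`det_intChoose_sub`). The differences between a position of `Q` and the two holes telescope into
factorials. After translating `Q` by `-(m + c)`, the summand is a constant times the summand
obtained by cutting a plain hexagon along a line (`pathCount_lower_mul_upper`). The ratio
`magnetBarRatio` does not depend on `Q`, so the sum is this ratio times the number of tilings of a
hexagon, which has a product formula by the same determinant (`pathCount_Ico_Ico`). -/

/-! ### Binomials with integer lower index and a binomial determinant. -/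

/-- The binomial coefficient with an integer lower index. -/
def intChoose (h : ℕ) (k : ℤ) : ℚ := if 0 ≤ k then (h.choose k.toNat : ℚ) else 0

/-- The reciprocal of the factorial, extended by zero to the negative integers. -/
def invFactorial (k : ℤ) : ℚ := if 0 ≤ k then ((k.toNat.factorial : ℚ))⁻¹ else 0

theorem intChoose_natCast (h k : ℕ) : intChoose h k = h.choose k := by
  simp [intChoose]

theorem intChoose_of_neg (h : ℕ) {k : ℤ} (hk : k < 0) : intChoose h k = 0 := by
  simp [intChoose, not_le.2 hk]

theorem intChoose_zero (k : ℤ) : intChoose 0 k = if k = 0 then 1 else 0 := by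
  rcases lt_or_ge k 0 with hk | hk
  · rw [intChoose_of_neg _ hk, if_neg hk.ne]
  · lift k to ℕ using hk
    rw [intChoose_natCast]
    cases k <;> simp
    norm_cast

theorem intChoose_succ (h : ℕ) (k : ℤ) :
    intChoose (h + 1) k = intChoose h k + intChoose h (k - 1) := by
  rcases lt_or_ge k 0 with hk | hk
  · rw [intChoose_of_neg _ hk, intChoose_of_neg _ hk, intChoose_of_neg _ (by omega), add_zero]
  · lift k to ℕ using hk
    cases k with
    | zero => simp [intChoose]
    | succ k =>
      have : ((k + 1 : ℕ) : ℤ) - 1 = (k : ℕ) := by push_cast; ring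
      rw [this, intChoose_natCast, intChoose_natCast, intChoose_natCast, Nat.choose_succ_succ]
      push_cast; ring

theorem intChoose_symm (h : ℕ) (k : ℤ) : intChoose h (h - k) = intChoose h k := by
  rcases lt_or_ge k 0 with hk | hk
  · rw [intChoose_of_neg _ hk]
    have : (h : ℤ) - k = ((h + (-k).toNat : ℕ) : ℤ) := by push_cast; omega
    rw [this, intChoose_natCast, Nat.choose_eq_zero_of_lt (by omega), Nat.cast_zero]
  · lift k to ℕ using hk
    rcases le_or_gt k h with hkh | hkh
    · rw [← Nat.cast_sub hkh, intChoose_natCast, intChoose_natCast, Nat.choose_symm hkh]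
    · rw [intChoose_of_neg _ (by omega), intChoose_natCast, Nat.choose_eq_zero_of_lt hkh,
        Nat.cast_zero]

theorem invFactorial_natCast (k : ℕ) : invFactorial k = ((k.factorial : ℚ))⁻¹ := by
  simp [invFactorial]

theorem invFactorial_of_neg {k : ℤ} (hk : k < 0) : invFactorial k = 0 := by
  simp [invFactorial, not_le.2 hk]

/-- Vandermonde convolution, by Pascal's rule in `k`. The bound `j + k < n` ensures that `range n`
contains every `l` with `0 ≤ l - j ≤ k`, so no nonzero term is cut off. -/
theorem sum_intChoose_mul_intChoose (h n k : ℕ) (z : ℤ) (j : ℕ) (hjk : j + k < n) :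
    ∑ l ∈ range n, intChoose h (z - l) * intChoose k ((l : ℤ) - j) = intChoose (h + k) (z - j) := by
  induction k generalizing j with
  | zero =>
    rw [sum_eq_single j]
    · simp [intChoose_zero]
    · intro l _ hl
      rw [intChoose_zero, if_neg (by omega), mul_zero]
    · intro hj
      simp at hj
      omega
  | succ k ih =>
    have h1 := ih j (by omega)
    have h2 := ih (j + 1) (by omega)
    rw [← add_assoc, intChoose_succ, ← h1]
    have e : z - j - 1 = z - ((j + 1 : ℕ) : ℤ) := by push_cast; ring
    rw [e, ← h2, ← sum_add_distrib]
    refine sum_congr rfl fun l _ => ?_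
    rw [intChoose_succ, mul_add]
    congr 3
    push_cast; ring

/-- Isolates the dependence on `j` in a polynomial in `z`. It holds for all integers `z`: outside `0
≤ z ≤ k + j` a reciprocal factorial vanishes, and for `0 ≤ z < j` the falling factorial does. -/
theorem intChoose_sub_eq_descPochhammer (k j : ℕ) (z : ℤ) :
    intChoose k (z - j) = k.factorial * (invFactorial z * invFactorial ((k + j : ℕ) - z)) *
      (descPochhammer ℚ j).eval (z : ℚ) := by
  rcases lt_or_ge z 0 with hz | hz
  · rw [intChoose_of_neg _ (by omega), invFactorial_of_neg hz]; ring
  lift z to ℕ using hz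
  rw [Int.cast_natCast, descPochhammer_eval_eq_descFactorial]
  rcases lt_or_ge z j with hzj | hzj
  · rw [intChoose_of_neg _ (by omega), Nat.descFactorial_eq_zero_iff_lt.2 hzj]; simp
  rw [← Nat.cast_sub hzj, intChoose_natCast]
  rcases lt_or_ge (k + j) z with hkz | hkz
  · rw [invFactorial_of_neg (k := (k + j : ℕ) - (z : ℤ)) (by omega),
      Nat.choose_eq_zero_of_lt (by omega)]
    simp
  rw [← Nat.cast_sub hkz, invFactorial_natCast, invFactorial_natCast, Nat.cast_choose ℚ (by omega),
    ← Nat.factorial_mul_descFactorial hzj]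
  have e : k - (z - j) = k + j - z := by omega
  rw [e]
  have h1 : ((z - j).factorial : ℚ) ≠ 0 := by positivity
  have h2 : ((k + j - z).factorial : ℚ) ≠ 0 := by positivity
  have h3 : (z.descFactorial j : ℚ) ≠ 0 := by
    exact_mod_cast (Nat.descFactorial_pos.2 hzj).ne'
  push_cast
  field_simp

/-- The binomial determinant with consecutive shifts in one index. -/
theorem det_intChoose_sub (h n : ℕ) (q : Fin n → ℤ) :
    (Matrix.of fun i j : Fin n => intChoose h (q i - (j : ℕ))).det =
      (∏ j ∈ range n, ((h + j).factorial : ℚ)) *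
        (∏ i, invFactorial (q i) * invFactorial (h + n - 1 - q i)) *
        ∏ i, ∏ j ∈ Ioi i, ((q j : ℚ) - q i) := by
  -- A unitriangular column operation. By Vandermonde convolution it turns the `j`-th column into
  -- `intChoose (h + n - 1 - j) (q i - j)`, where upper index plus `j` is constant. The row factors
  -- then no longer depend on `j`, and monic falling factorials of degree `j` remain.
  set T : Matrix (Fin n) (Fin n) ℚ :=
    Matrix.of fun l j => intChoose (n - 1 - j) (((l : ℕ) : ℤ) - (j : ℕ)) with hT
  have hdetT : T.det = 1 := by
    rw [Matrix.det_of_isLowerTriangular]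
    · refine prod_eq_one fun i _ => ?_
      simp [hT, intChoose]
    · intro i j hij
      have hij' : i < j := hij
      simp only [hT, Matrix.of_apply]
      exact intChoose_of_neg _ (by have := Fin.lt_def.1 hij'; omega)
  rw [← mul_one (Matrix.det _), ← hdetT, ← Matrix.det_mul]
  have key : (Matrix.of fun i j : Fin n => intChoose h (q i - (j : ℕ))) * T =
      Matrix.of fun i j : Fin n => (invFactorial (q i) * invFactorial (h + n - 1 - q i)) *
        (Matrix.of fun i j : Fin n => ((h + (n - 1 - j)).factorial : ℚ) *
          (Matrix.of fun i j : Fin n =>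
            (descPochhammer ℚ j).eval (q i : ℚ)) i j) i j := by
    ext i j
    simp only [Matrix.mul_apply, Matrix.of_apply, hT]
    rw [Fin.sum_univ_eq_sum_range
      (fun l => intChoose h (q i - l) * intChoose (n - 1 - j) ((l : ℤ) - (j : ℕ))) n,
      sum_intChoose_mul_intChoose h n _ _ _ (by omega), intChoose_sub_eq_descPochhammer]
    have e : ((h + (n - 1 - j) + j : ℕ) : ℤ) = h + n - 1 := by have := j.2; omega
    rw [e]
    ring
  rw [key, Matrix.det_mul_column, Matrix.det_mul_row]
  have hv := Matrix.det_eval_matrixOfPolynomials_eq_det_vandermonde (fun i => (q i : ℚ))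
    (fun j : Fin n => descPochhammer ℚ j) (fun j => descPochhammer_natDegree ℚ j)
    (fun j => monic_descPochhammer ℚ j)
  rw [← hv, Matrix.det_vandermonde]
  have hp : ∏ j : Fin n, ((h + (n - 1 - j)).factorial : ℚ) =
      ∏ j ∈ range n, ((h + j).factorial : ℚ) := by
    rw [Fin.prod_univ_eq_prod_range (fun j => ((h + (n - 1 - j)).factorial : ℚ)) n,
      prod_range_reflect (fun j => ((h + j).factorial : ℚ)) n]
  rw [hp]
  ring

/-! ### Nonintersecting lattice paths and their determinant. -/

/-- `A` is obtained from `B` by moving each element up by `0` or `1`, without collisions. -/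
def IsShift (A B : Set ℤ) : Prop :=
  ∃ f : ℤ → ℤ, Set.BijOn f A B ∧ ∀ i, f i = i ∨ f i = i - 1

theorem IsShift.exists_pred {A B : Set ℤ} (h : IsShift A B) {i : ℤ} (hi : i ∈ A) :
    i ∈ B ∨ i - 1 ∈ B := by
  obtain ⟨f, hf, hs⟩ := h
  have := hf.mapsTo hi
  rcases hs i with h | h <;> rw [h] at this <;> simp [this]

theorem IsShift.exists_succ {A B : Set ℤ} (h : IsShift A B) {i : ℤ} (hi : i ∈ B) :
    i ∈ A ∨ i + 1 ∈ A := by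
  obtain ⟨f, hf, hs⟩ := h
  obtain ⟨k, hk, rfl⟩ := hf.surjOn hi
  rcases hs k with h | h <;> rw [h] <;> simp [hk]

theorem IsShift.card_eq {A B : Finset ℤ} (h : IsShift A B) : #A = #B := by
  obtain ⟨f, hf, -⟩ := h
  exact hf.finsetCard_eq

open Classical in
/-- The finite sets from which `Q` arises by a shift. -/
noncomputable def shiftPreds (Q : Finset ℤ) : Finset (Finset ℤ) :=
  (Q ∪ Q.image (· - 1)).powerset.filter fun P => IsShift Q P

theorem mem_shiftPreds {P Q : Finset ℤ} : P ∈ shiftPreds Q ↔ IsShift Q P := by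
  simp only [shiftPreds, mem_filter, mem_powerset, and_iff_right_iff_imp]
  intro h i hi
  rcases h.exists_succ (mem_coe.2 hi) with h | h
  · exact mem_union_left _ h
  · exact mem_union_right _ (mem_image.2 ⟨i + 1, h, by ring⟩)

/-- The number of families of nonintersecting lattice paths with `h` steps from `P` to `Q`. -/
noncomputable def pathCount (P : Finset ℤ) : ℕ → Finset ℤ → ℕ
  | 0, Q => if P = Q then 1 else 0
  | h + 1, Q => ∑ Q' ∈ shiftPreds Q, pathCount P h Q'

theorem card_eq_of_pathCount_ne_zero {P Q : Finset ℤ} {h : ℕ} (hne : pathCount P h Q ≠ 0) :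
    #P = #Q := by
  induction h generalizing Q with
  | zero =>
    simp only [pathCount, ne_eq, ite_eq_right_iff, one_ne_zero, imp_false, not_not] at hne
    rw [hne]
  | succ h ih =>
    obtain ⟨Q', hQ', hne'⟩ := exists_ne_zero_of_sum_ne_zero hne
    rw [ih hne', (mem_shiftPreds.1 hQ').card_eq]

theorem subset_Ico_of_pathCount_ne_zero {P Q : Finset ℤ} {h : ℕ} (hne : pathCount P h Q ≠ 0) {a b : ℤ}
    (hP : P ⊆ Ico a b) : Q ⊆ Ico a (b + h) := by
  induction h generalizing Q with
  | zero =>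
    simp only [pathCount, ne_eq, ite_eq_right_iff, one_ne_zero, imp_false, not_not] at hne
    simpa [← hne] using hP
  | succ h ih =>
    obtain ⟨Q', hQ', hne'⟩ := exists_ne_zero_of_sum_ne_zero hne
    intro i hi
    have := ih hne'
    rcases (mem_shiftPreds.1 hQ').exists_pred (mem_coe.2 hi) with h | h <;>
    · have := mem_Ico.1 (this h)
      rw [mem_Ico]
      push_cast
      omega

/-- Cuts the paths after `h` steps. Any finite family containing all reachable intermediate sets
will do, since the others contribute zero. -/
theorem pathCount_add (P Q : Finset ℤ) (h k : ℕ) (𝒬 : Finset (Finset ℤ))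
    (h𝒬 : ∀ Q', pathCount P h Q' ≠ 0 → Q' ∈ 𝒬) :
    pathCount P (h + k) Q = ∑ Q' ∈ 𝒬, pathCount P h Q' * pathCount Q' k Q := by
  induction k generalizing Q with
  | zero =>
    simp only [pathCount, mul_ite, mul_one, mul_zero, add_zero, sum_ite_eq']
    split_ifs with hQ
    · rfl
    · by_contra hne
      exact hQ (h𝒬 Q hne)
  | succ k ih =>
    rw [← add_assoc, pathCount, sum_congr rfl fun Q' _ => ih Q', sum_comm]
    simp only [pathCount, mul_sum]

theorem StrictMono.eq_of_image_eq {n : ℕ} {p q : Fin n → ℤ} (hp : StrictMono p) (hq : StrictMono q)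
    (h : univ.image p = univ.image q) : p = q := by
  refine (hp.range_inj hq).1 ?_
  have := congrArg (fun s : Finset ℤ => (s : Set ℤ)) h
  simpa using this

open Classical in
-- A shift preserves order: distinct integers that each drop by at most 1 without colliding stay in
-- order. So a predecessor is given by the set `s` of indices that stay put, subject to strict
-- monotonicity.
theorem sum_shiftPreds_image {n : ℕ} {q : Fin n → ℤ} (hq : StrictMono q) (F : Finset ℤ → ℚ) :
    ∑ Q' ∈ shiftPreds (univ.image q), F Q' =
      ∑ s : Finset (Fin n), if StrictMono (fun i => q i - if i ∈ s then 0 else 1) then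
        F (univ.image fun i => q i - if i ∈ s then 0 else 1) else 0 := by
  rw [← sum_filter]
  symm
  refine sum_bij (fun s _ => univ.image fun i => q i - if i ∈ s then 0 else 1) ?_ ?_ ?_ ?_
  · intro s hs
    have hs : StrictMono _ := (mem_filter.1 hs).2
    rw [mem_shiftPreds]
    have hinv : ∀ i, Function.extend q (fun i => q i - if i ∈ s then 0 else 1) id (q i) =
        q i - if i ∈ s then 0 else 1 := fun i => hq.injective.extend_apply _ _ i
    refine ⟨Function.extend q (fun i => q i - if i ∈ s then 0 else 1) id, ⟨?_, ?_, ?_⟩, ?_⟩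
    · intro z hz
      obtain ⟨i, -, rfl⟩ := mem_image.1 hz
      rw [hinv]
      exact mem_image_of_mem (fun i => q i - if i ∈ s then 0 else 1) (mem_univ i)
    · intro z hz z' hz' hzz
      obtain ⟨i, -, rfl⟩ := mem_image.1 hz
      obtain ⟨j, -, rfl⟩ := mem_image.1 hz'
      rw [hinv, hinv] at hzz
      rw [hs.injective hzz]
    · intro z hz
      obtain ⟨i, -, rfl⟩ := mem_image.1 hz
      exact ⟨q i, by simp, hinv i⟩
    · intro z
      by_cases hz : ∃ i, q i = z
      · obtain ⟨i, rfl⟩ := hz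
        rw [hinv]
        split_ifs <;> simp
      · rw [Function.extend_apply' _ _ _ hz]
        exact Or.inl rfl
  · intro s hs t ht hst
    have hs : StrictMono _ := (mem_filter.1 hs).2
    have ht : StrictMono _ := (mem_filter.1 ht).2
    have := hs.eq_of_image_eq ht hst
    ext i
    have hi := congrFun this i
    by_cases h1 : i ∈ s <;> by_cases h2 : i ∈ t <;>
      simp only [h1, h2, if_true, if_false] at hi ⊢ <;> omega
  · intro Q' hQ'
    obtain ⟨f, hf, hfs⟩ := mem_shiftPreds.1 hQ'
    have e : (fun i => q i - if i ∈ univ.filter (fun i => f (q i) = q i) then 0 else 1) =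
        fun i => f (q i) := by
      funext i
      rcases hfs (q i) with h | h
      · simp [h]
      · simp [h]
    have hmem : ∀ i, q i ∈ ((univ.image q : Finset ℤ) : Set ℤ) := fun i => by simp
    refine ⟨univ.filter fun i => f (q i) = q i, ?_, ?_⟩
    · rw [mem_filter, e]
      refine ⟨mem_univ _, fun i j hij => ?_⟩
      have h1 := hq hij
      have h2 : f (q i) ≠ f (q j) := fun h => h1.ne (hf.injOn (hmem i) (hmem j) h)
      dsimp only
      rcases hfs (q i) with h | h <;> rcases hfs (q j) with h' | h' <;> omega
    · rw [e]
      ext z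
      constructor
      · intro hz
        obtain ⟨i, -, rfl⟩ := mem_image.1 hz
        exact hf.mapsTo (hmem i)
      · intro hz
        obtain ⟨w, hw, rfl⟩ := hf.surjOn (mem_coe.2 hz)
        obtain ⟨i, -, rfl⟩ := mem_image.1 hw
        exact mem_image.2 ⟨i, mem_univ _, rfl⟩
  · intro s _
    rfl

/-- The Lindström–Gessel–Viennot determinant. -/
theorem pathCount_eq_det {n : ℕ} {p q : Fin n → ℤ} (hp : StrictMono p) (hq : StrictMono q)
    (h : ℕ) : (pathCount (univ.image p) h (univ.image q) : ℚ) =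
      (Matrix.of fun i j => intChoose h (q i - p j)).det := by
  classical
  induction h generalizing q with
  | zero =>
    simp only [pathCount, Nat.cast_ite, Nat.cast_one, Nat.cast_zero]
    split_ifs with hpq
    · have := hp.eq_of_image_eq hq hpq
      subst this
      have : (Matrix.of fun i j => intChoose 0 (p i - p j)) = (1 : Matrix (Fin n) (Fin n) ℚ) := by
        ext i j
        simp [intChoose_zero, sub_eq_zero, Matrix.one_apply, hp.injective.eq_iff]
      rw [this, Matrix.det_one]
    · obtain ⟨i, hi⟩ : ∃ i, q i ∉ univ.image p := by
        by_contra! hcon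
        apply hpq
        symm
        apply eq_of_subset_of_card_le
        · intro z hz
          obtain ⟨i, -, rfl⟩ := mem_image.1 hz
          exact hcon i
        · rw [card_image_of_injective _ hp.injective, card_image_of_injective _ hq.injective]
      symm
      refine Matrix.det_eq_zero_of_row_eq_zero i fun j => ?_
      simp only [Matrix.of_apply, intChoose_zero, sub_eq_zero]
      rw [if_neg]
      intro hij
      exact hi (mem_image.2 ⟨j, mem_univ _, hij.symm⟩)
  | succ h ih =>
    rw [pathCount, Nat.cast_sum, sum_shiftPreds_image hq fun Q => (pathCount (univ.image p) h Q : ℚ)]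
    have hadd : (Matrix.of fun i j => intChoose (h + 1) (q i - p j)) =
        (fun i j => intChoose h (q i - p j)) + fun i j => intChoose h (q i - p j - 1) := by
      ext i j
      exact intChoose_succ _ _
    -- Pascal's rule splits each row in two, and multilinearity expands the determinant over subsets
    -- of rows, matching the sum over last steps.
    have hdet := (Matrix.detRowAlternating (n := Fin n) (R := ℚ)).toMultilinearMap.map_add_univ
      (fun i j => intChoose h (q i - p j)) (fun i j => intChoose h (q i - p j - 1))
    rw [hadd]
    refine Eq.trans ?_ hdet.symm
    refine sum_congr rfl fun s _ => ?_
    have hpw : s.piecewise (fun i j => intChoose h (q i - p j))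
        (fun i j => intChoose h (q i - p j - 1)) =
        Matrix.of fun i j => intChoose h ((q i - if i ∈ s then 0 else 1) - p j) := by
      ext i j
      by_cases hi : i ∈ s
      · simp [hi]
      · simp [hi, sub_right_comm]
    rw [hpw]
    change _ = Matrix.det _
    split_ifs with hs
    · exact ih hs
    -- Moving down by at most 1 keeps the positions weakly increasing. If not strictly so, two of
    -- them coincide, and the determinant has two equal rows. This replaces the usual exchange of
    -- path tails.
    · have hmono : Monotone fun i => q i - if i ∈ s then 0 else 1 := by
        intro i j hij
        rcases hij.eq_or_lt with rfl | hij
        · rfl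
        · have := hq hij
          dsimp only
          split_ifs <;> omega
      have hinj : ¬ Function.Injective fun i => q i - if i ∈ s then 0 else 1 :=
        fun hi => hs (hmono.strictMono_of_injective hi)
      simp only [Function.Injective, not_forall] at hinj
      obtain ⟨i, j, hij, hne⟩ := hinj
      symm
      refine Matrix.det_zero_of_row_eq hne ?_
      funext k
      simp only [Matrix.of_apply]
      rw [hij]

/-! ### Product formulas when one end set is an interval. -/

/-- The product of all differences of elements of a finite set, larger minus smaller. -/
def finsetVandermonde (Q : Finset ℤ) : ℚ := ∏ p ∈ Q, ∏ q ∈ Q with p < q, ((q : ℚ) - p)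

theorem finsetVandermonde_image {n : ℕ} {q : Fin n → ℤ} (hq : StrictMono q) :
    finsetVandermonde (univ.image q) = ∏ i, ∏ j ∈ Ioi i, ((q j : ℚ) - q i) := by
  rw [finsetVandermonde, prod_image hq.injective.injOn]
  refine prod_congr rfl fun i _ => ?_
  rw [filter_image, prod_image hq.injective.injOn]
  refine prod_congr ?_ fun _ _ => rfl
  ext j
  simp [hq.lt_iff_lt]

theorem finsetVandermonde_union {P Q : Finset ℤ} (h : ∀ p ∈ P, ∀ q ∈ Q, p < q) :
    finsetVandermonde (P ∪ Q) =
      finsetVandermonde P * finsetVandermonde Q * ∏ q ∈ Q, ∏ p ∈ P, ((q : ℚ) - p) := by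
  have hd : Disjoint P Q := disjoint_left.2 fun z hz hz' => (h z hz z hz').false
  rw [finsetVandermonde, prod_union hd]
  have h1 : ∀ p ∈ P, ∏ q ∈ P ∪ Q with p < q, ((q : ℚ) - p) =
      (∏ q ∈ P with p < q, ((q : ℚ) - p)) * ∏ q ∈ Q, ((q : ℚ) - p) := by
    intro p hp
    rw [filter_union, prod_union (disjoint_filter_filter hd), filter_true_of_mem (h p hp)]
  have h2 : ∀ p ∈ Q, ∏ q ∈ P ∪ Q with p < q, ((q : ℚ) - p) =
      ∏ q ∈ Q with p < q, ((q : ℚ) - p) := by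
    intro p hp
    rw [filter_union, filter_false_of_mem fun q hq => (h q hq p hp).le.not_gt, empty_union]
  rw [prod_congr rfl h1, prod_congr rfl h2, prod_mul_distrib, prod_comm (s := P) (t := Q)]
  simp only [finsetVandermonde]
  ring

theorem finsetVandermonde_image_add (P : Finset ℤ) (z : ℤ) :
    finsetVandermonde (P.image (· + z)) = finsetVandermonde P := by
  have hi : Function.Injective (· + z) := add_left_injective z
  rw [finsetVandermonde, prod_image hi.injOn]
  refine prod_congr rfl fun i _ => ?_
  rw [filter_image, prod_image hi.injOn]
  refine prod_congr ?_ fun _ _ => ?_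
  · ext j
    simp
  · push_cast; ring

theorem image_Ico_eq (z : ℤ) (n : ℕ) :
    Ico z (z + n) = univ.image fun j : Fin n => z + (j : ℕ) := by
  ext w
  simp only [mem_Ico, mem_image, mem_univ, true_and]
  constructor
  · rintro ⟨h1, h2⟩
    exact ⟨⟨(w - z).toNat, by omega⟩, by simp; omega⟩
  · rintro ⟨j, rfl⟩
    have := j.2
    omega

theorem strictMono_add_fin (z : ℤ) (n : ℕ) : StrictMono fun j : Fin n => z + (j : ℕ) := by
  intro i j hij
  have := Fin.lt_def.1 hij
  dsimp only
  omega

theorem exists_strictMono_image_eq {n : ℕ} {Q : Finset ℤ} (hQ : #Q = n) :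
    ∃ q : Fin n → ℤ, StrictMono q ∧ Q = univ.image q := by
  refine ⟨Q.orderEmbOfFin hQ, (Q.orderEmbOfFin hQ).strictMono, ?_⟩
  rw [← coe_inj]
  simp

theorem pathCount_Ico_left {n : ℕ} {Q : Finset ℤ} (hQ : #Q = n) (h : ℕ) :
    (pathCount (Ico 0 (n : ℤ)) h Q : ℚ) = (∏ j ∈ range n, ((h + j).factorial : ℚ)) *
      (∏ q ∈ Q, invFactorial q * invFactorial (h + n - 1 - q)) * finsetVandermonde Q := by
  obtain ⟨q, hq, rfl⟩ := exists_strictMono_image_eq hQ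
  rw [← zero_add (n : ℤ), image_Ico_eq, pathCount_eq_det (strictMono_add_fin 0 n) hq,
    finsetVandermonde_image hq, prod_image hq.injective.injOn]
  simp only [zero_add]
  exact det_intChoose_sub h n q

/-- Reversal of the paths: transposing and applying `intChoose_symm` puts the consecutive shifts in
the column index, as `det_intChoose_sub` requires. -/
theorem pathCount_Ico_right {n : ℕ} {P : Finset ℤ} (hP : #P = n) (h : ℕ) (z : ℤ) :
    (pathCount P h (Ico z (z + n)) : ℚ) = (∏ j ∈ range n, ((h + j).factorial : ℚ)) *
      (∏ p ∈ P, invFactorial (p + (h - z)) * invFactorial (z + n - 1 - p)) *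
      finsetVandermonde P := by
  obtain ⟨p, hp, rfl⟩ := exists_strictMono_image_eq hP
  rw [image_Ico_eq, pathCount_eq_det hp (strictMono_add_fin z n),
    finsetVandermonde_image hp, prod_image hp.injective.injOn, ← Matrix.det_transpose]
  have e : (Matrix.of fun i j : Fin n => intChoose h (z + (i : ℕ) - p j)).transpose =
      Matrix.of fun i j : Fin n => intChoose h (p i + (h - z) - (j : ℕ)) := by
    ext i j
    simp only [Matrix.transpose_apply, Matrix.of_apply]
    rw [← intChoose_symm]
    congr 1
    ring
  rw [e, det_intChoose_sub h n fun i => p i + (h - z)]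
  congr 1
  · congr 1
    refine prod_congr rfl fun i _ => ?_
    congr 2
    ring
  · refine prod_congr rfl fun i _ => prod_congr rfl fun j _ => ?_
    push_cast; ring

/-! ### Adjacency of unit triangles and lozenges. -/

namespace UnitTriangle

theorem adj_iff {s t : UnitTriangle} (hs : s.up = true) (ht : t.up = false) :
    s.Adj t ↔ (t.i = s.i ∧ t.j = s.j) ∨ (t.i = s.i - 1 ∧ t.j = s.j) ∨
      (t.i = s.i ∧ t.j = s.j - 1) := by
  obtain ⟨i, j, u⟩ := s
  obtain ⟨k, l, v⟩ := t
  dsimp only at hs ht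
  subst hs ht
  simp only [Adj, vertices, if_true]
  constructor
  · rintro ⟨-, h⟩
    obtain ⟨p, q, hpq, he⟩ := card_eq_two.1 h
    have hp : p ∈ ({p, q} : Finset (ℤ × ℤ)) := by simp
    have hq : q ∈ ({p, q} : Finset (ℤ × ℤ)) := by simp
    rw [← he] at hp hq
    obtain ⟨p1, p2⟩ := p
    obtain ⟨q1, q2⟩ := q
    simp only [mem_inter, mem_insert, mem_singleton, Prod.mk.injEq, ne_eq, Bool.false_eq_true,
      if_false] at hp hq hpq ⊢
    omega
  · intro h
    refine ⟨by simp, card_eq_two.2 ?_⟩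
    rcases h with ⟨rfl, rfl⟩ | ⟨rfl, rfl⟩ | ⟨rfl, rfl⟩
    · refine ⟨(k + 1, l), (k, l + 1), by simp, ?_⟩
      ext ⟨a, b⟩
      simp only [mem_inter, mem_insert, mem_singleton, Prod.mk.injEq, Bool.false_eq_true, if_false]
      omega
    · refine ⟨(i, l), (i, l + 1), by simp, ?_⟩
      ext ⟨a, b⟩
      simp only [mem_inter, mem_insert, mem_singleton, Prod.mk.injEq, Bool.false_eq_true, if_false]
      omega
    · refine ⟨(k, j), (k + 1, j), by simp, ?_⟩
      ext ⟨a, b⟩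
      simp only [mem_inter, mem_insert, mem_singleton, Prod.mk.injEq, Bool.false_eq_true, if_false]
      omega

theorem Adj.up_ne {s t : UnitTriangle} (h : s.Adj t) : s.up ≠ t.up := by
  intro hup
  obtain ⟨hne, h⟩ := h
  obtain ⟨p, q, hpq, he⟩ := card_eq_two.1 h
  have hp : p ∈ ({p, q} : Finset (ℤ × ℤ)) := by simp
  have hq : q ∈ ({p, q} : Finset (ℤ × ℤ)) := by simp
  rw [← he] at hp hq
  obtain ⟨p1, p2⟩ := p
  obtain ⟨q1, q2⟩ := q
  obtain ⟨i, j, u⟩ := s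
  obtain ⟨k, l, v⟩ := t
  dsimp only at hup
  subst hup
  simp only [ne_eq, mk.injEq, and_true] at hne
  cases u <;>
  · simp only [vertices, mem_inter, mem_insert, mem_singleton, Prod.mk.injEq, ne_eq,
      Bool.false_eq_true, if_false, if_true] at hp hq hpq
    omega

theorem Adj.symm {s t : UnitTriangle} (h : s.Adj t) : t.Adj s :=
  ⟨h.1.symm, by rw [inter_comm]; exact h.2⟩

end UnitTriangle

/-- The lozenge formed by the up-pointing triangle at `p` and the down-pointing one at `q`. -/
def lozengeOf (p q : ℤ × ℤ) : Finset UnitTriangle := {⟨p.1, p.2, true⟩, ⟨q.1, q.2, false⟩}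

/-- The down-pointing triangle at `q` shares an edge with the up-pointing triangle at `p`. -/
def DownAdj (p q : ℤ × ℤ) : Prop := q = p ∨ q = (p.1 - 1, p.2) ∨ q = (p.1, p.2 - 1)

theorem isLozenge_iff {L : Finset UnitTriangle} :
    IsLozenge L ↔ ∃ p q, DownAdj p q ∧ L = lozengeOf p q := by
  constructor
  · rintro ⟨s, t, h, rfl⟩
    wlog hs : s.up = true generalizing s t
    · have := this t s h.symm (by have := h.up_ne; revert this; revert hs; cases s.up <;> simp)
      rwa [pair_comm]
    have ht : t.up = false := by have := h.up_ne; rw [hs] at this; simpa using this.symm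
    refine ⟨(s.i, s.j), (t.i, t.j), ?_, ?_⟩
    · have := (UnitTriangle.adj_iff hs ht).1 h
      simpa [DownAdj, Prod.ext_iff] using this
    · obtain ⟨i, j, u⟩ := s
      obtain ⟨k, l, v⟩ := t
      dsimp only at hs ht
      subst hs ht
      rfl
  · rintro ⟨p, q, h, rfl⟩
    refine ⟨_, _, (UnitTriangle.adj_iff rfl rfl).2 ?_, rfl⟩
    simpa [DownAdj, Prod.ext_iff] using h

theorem up_mem_lozenge {p q r : ℤ × ℤ} : (⟨r.1, r.2, true⟩ : UnitTriangle) ∈ lozengeOf p q ↔ r = p := by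
  simp [lozengeOf, Prod.ext_iff]

theorem down_mem_lozenge {p q r : ℤ × ℤ} :
    (⟨r.1, r.2, false⟩ : UnitTriangle) ∈ lozengeOf p q ↔ r = q := by
  simp [lozengeOf, Prod.ext_iff]

theorem lozenge_inj {p q p' q' : ℤ × ℤ} : lozengeOf p q = lozengeOf p' q' ↔ p = p' ∧ q = q' := by
  constructor
  · intro h
    have h1 : (⟨p.1, p.2, true⟩ : UnitTriangle) ∈ lozengeOf p' q' := h ▸ up_mem_lozenge.2 rfl
    have h2 : (⟨q.1, q.2, false⟩ : UnitTriangle) ∈ lozengeOf p' q' := h ▸ down_mem_lozenge.2 rfl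
    exact ⟨up_mem_lozenge.1 h1, down_mem_lozenge.1 h2⟩
  · rintro ⟨rfl, rfl⟩
    rfl

/-! ### Tilings encoded by their crossing lozenges. -/

/-- The positions of the up-pointing triangles of `R`. -/
def ups (R : Set UnitTriangle) : Set (ℤ × ℤ) := {p | (⟨p.1, p.2, true⟩ : UnitTriangle) ∈ R}

/-- The positions of the down-pointing triangles of `R`. -/
def downs (R : Set UnitTriangle) : Set (ℤ × ℤ) := {p | (⟨p.1, p.2, false⟩ : UnitTriangle) ∈ R}

section Tiling

variable {R : Set UnitTriangle} {T : Set (Finset UnitTriangle)}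

theorem IsLozengeTiling.eq_of_mem (hT : IsLozengeTiling R T) {L L' : Finset UnitTriangle}
    (hL : L ∈ T) (hL' : L' ∈ T) {t : UnitTriangle} (h : t ∈ L) (h' : t ∈ L') : L = L' := by
  by_contra hne
  exact disjoint_left.1 (hT.disjoint hL hL' hne) h h'

theorem IsLozengeTiling.mem_ups (hT : IsLozengeTiling R T) {p q : ℤ × ℤ} (h : lozengeOf p q ∈ T) :
    p ∈ ups R := (hT.cover _).2 ⟨_, h, up_mem_lozenge.2 rfl⟩

theorem IsLozengeTiling.mem_downs (hT : IsLozengeTiling R T) {p q : ℤ × ℤ}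
    (h : lozengeOf p q ∈ T) : q ∈ downs R := (hT.cover _).2 ⟨_, h, down_mem_lozenge.2 rfl⟩

theorem IsLozengeTiling.exists_of_up (hT : IsLozengeTiling R T) {p : ℤ × ℤ} (hp : p ∈ ups R) :
    ∃ q, DownAdj p q ∧ lozengeOf p q ∈ T := by
  obtain ⟨L, hL, hpL⟩ := (hT.cover _).1 hp
  obtain ⟨p', q, h, rfl⟩ := isLozenge_iff.1 (hT.lozenge L hL)
  rw [up_mem_lozenge] at hpL
  subst hpL
  exact ⟨q, h, hL⟩

theorem IsLozengeTiling.exists_of_down (hT : IsLozengeTiling R T) {q : ℤ × ℤ} (hq : q ∈ downs R) :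
    ∃ p, DownAdj p q ∧ lozengeOf p q ∈ T := by
  obtain ⟨L, hL, hqL⟩ := (hT.cover _).1 hq
  obtain ⟨p, q', h, rfl⟩ := isLozenge_iff.1 (hT.lozenge L hL)
  rw [down_mem_lozenge] at hqL
  subst hqL
  exact ⟨p, h, hL⟩

theorem IsLozengeTiling.down_unique (hT : IsLozengeTiling R T) {p q q' : ℤ × ℤ}
    (h : lozengeOf p q ∈ T) (h' : lozengeOf p q' ∈ T) : q = q' :=
  (lozenge_inj.1 (hT.eq_of_mem h h' (up_mem_lozenge.2 rfl) (up_mem_lozenge.2 rfl))).2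

theorem IsLozengeTiling.up_unique (hT : IsLozengeTiling R T) {p p' q : ℤ × ℤ}
    (h : lozengeOf p q ∈ T) (h' : lozengeOf p' q ∈ T) : p = p' :=
  (lozenge_inj.1 (hT.eq_of_mem h h' (down_mem_lozenge.2 rfl) (down_mem_lozenge.2 rfl))).1

/-- A bijection between the up-pointing and the down-pointing triangles of `R` that pairs adjacent
triangles gives a lozenge tiling. -/
theorem isLozengeTiling_of_bijOn {g : ℤ × ℤ → ℤ × ℤ} (hg : Set.BijOn g (ups R) (downs R))
    (hadj : ∀ p, DownAdj p (g p)) :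
    IsLozengeTiling R ((fun p => lozengeOf p (g p)) '' ups R) where
  lozenge := by
    rintro _ ⟨p, -, rfl⟩
    exact isLozenge_iff.2 ⟨p, g p, hadj p, rfl⟩
  disjoint := by
    rintro _ ⟨p, hp, rfl⟩ _ ⟨p', hp', rfl⟩ hne
    refine disjoint_left.2 ?_
    rintro ⟨i, j, u⟩ h h'
    apply hne
    cases u
    · have h1 := (down_mem_lozenge (r := (i, j))).1 h
      have h2 := (down_mem_lozenge (r := (i, j))).1 h'
      rw [hg.injOn hp hp' (h1.symm.trans h2)]
    · have h1 := (up_mem_lozenge (r := (i, j))).1 h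
      have h2 := (up_mem_lozenge (r := (i, j))).1 h'
      rw [← h1, ← h2]
  cover := by
    rintro ⟨i, j, u⟩
    constructor
    · intro h
      cases u
      · obtain ⟨p, hp, hpg⟩ := hg.surjOn (show (i, j) ∈ downs R from h)
        exact ⟨_, ⟨p, hp, rfl⟩, (down_mem_lozenge (r := (i, j))).2 hpg.symm⟩
      · exact ⟨_, ⟨(i, j), h, rfl⟩, (up_mem_lozenge (r := (i, j))).2 rfl⟩
    · rintro ⟨_, ⟨p, hp, rfl⟩, h⟩
      cases u
      · have h1 := (down_mem_lozenge (r := (i, j))).1 h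
        have := hg.mapsTo hp
        rw [← h1] at this
        exact this
      · have h1 := (up_mem_lozenge (r := (i, j))).1 h
        rw [← h1] at hp
        exact hp

/-- The positions on the line through the upper edges of the strip of index `s` of the up-pointing
triangles of `R` in that strip that are not in `C`. -/
def freeUps (R : Set UnitTriangle) (C : Set (ℤ × ℤ)) (s : ℤ) : Set ℤ :=
  {i | (i, s - i) ∈ ups R ∧ (i, s - i) ∉ C}

/-- The positions of the down-pointing triangles of `R` in the strip of index `s` that are not
in `C`. -/
def freeDowns (R : Set UnitTriangle) (C : Set (ℤ × ℤ)) (s : ℤ) : Set ℤ :=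
  {i | (i, s - 1 - i) ∈ downs R ∧ (i, s - 1 - i) ∉ C}

/-- The sets of lozenges with an edge of direction `(1, -1)` in the middle that extend to a tiling
of `R`. -/
def crossingSets (R : Set UnitTriangle) : Set (Set (ℤ × ℤ)) :=
  {C | C ⊆ ups R ∩ downs R ∧ ∀ s, IsShift (freeUps R C s) (freeDowns R C s)}

/-- The lozenges of `T` with an edge of direction `(1, -1)` in the middle. -/
def crossings (T : Set (Finset UnitTriangle)) : Set (ℤ × ℤ) := {p | lozengeOf p p ∈ T}

/-- A lozenge that is not a crossing joins an up-pointing and a down-pointing triangle of the same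
strip, whose first coordinates differ by 0 or 1. These lozenges match the free triangles of the
strip. -/
theorem IsLozengeTiling.isShift (hT : IsLozengeTiling R T) (s : ℤ) :
    ∃ f : ℤ → ℤ, Set.BijOn f (freeUps R (crossings T) s) (freeDowns R (crossings T) s) ∧
      (∀ i, f i = i ∨ f i = i - 1) ∧
      ∀ i ∈ freeUps R (crossings T) s, lozengeOf (i, s - i) (f i, s - 1 - f i) ∈ T := by
  classical
  set f : ℤ → ℤ := fun i => if lozengeOf (i, s - i) (i - 1, s - i) ∈ T then i - 1 else i with hf
  have hs : ∀ i, f i = i ∨ f i = i - 1 := by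
    intro i
    simp only [hf]
    split_ifs <;> simp
  have hfT : ∀ i ∈ freeUps R (crossings T) s, lozengeOf (i, s - i) (f i, s - 1 - f i) ∈ T := by
    rintro i ⟨hi, hiC⟩
    simp only [hf]
    split_ifs with h
    · convert h using 3
      ring
    · obtain ⟨q, hq | hq | hq, hqT⟩ := hT.exists_of_up hi
      · subst hq
        exact absurd hqT hiC
      · subst hq
        exact absurd hqT h
      · subst hq
        convert hqT using 3
        dsimp only
        ring
  refine ⟨f, ⟨?_, ?_, ?_⟩, hs, hfT⟩
  · intro i hi
    refine ⟨hT.mem_downs (hfT i hi), fun hc => ?_⟩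
    have := hT.up_unique (hfT i hi) hc
    simp only [Prod.mk.injEq] at this
    omega
  · intro i hi i' hi' h
    have h1 := hfT i hi
    rw [h] at h1
    exact (Prod.mk.injEq .. ▸ hT.up_unique h1 (hfT i' hi')).1
  · rintro k ⟨hk, hkC⟩
    obtain ⟨⟨i, j⟩, h, hpT⟩ := hT.exists_of_down hk
    have hij : i + j = s ∧ ¬ (i = k ∧ j = s - 1 - k) := by
      refine ⟨?_, fun hc => ?_⟩
      · rcases h with h | h | h
        · rw [← h] at hpT
          exact absurd hpT hkC
        · simp only [Prod.mk.injEq] at h; omega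
        · simp only [Prod.mk.injEq] at h; omega
      · rw [hc.1, hc.2] at hpT
        exact hkC hpT
    obtain rfl : j = s - i := by omega
    have hi : i ∈ freeUps R (crossings T) s := by
      refine ⟨hT.mem_ups hpT, fun hc => ?_⟩
      have := hT.down_unique hpT hc
      simp only [Prod.mk.injEq] at this
      omega
    refine ⟨i, hi, ?_⟩
    have := hT.down_unique (hfT i hi) hpT
    simp only [Prod.mk.injEq] at this
    exact this.1

theorem IsLozengeTiling.crossings_mem (hT : IsLozengeTiling R T) :
    crossings T ∈ crossingSets R := by
  refine ⟨fun p hp => ⟨hT.mem_ups hp, hT.mem_downs hp⟩, fun s => ?_⟩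
  obtain ⟨f, hf, hs, -⟩ := hT.isShift s
  exact ⟨f, hf, hs⟩

/-- A bijection that moves each element by `0` or `-1` is unique. -/
theorem eqOn_of_bijOn_shift {A B : Set ℤ} {f g : ℤ → ℤ} (hf : Set.BijOn f A B)
    (hg : Set.BijOn g A B) (hfs : ∀ i, f i = i ∨ f i = i - 1) (hgs : ∀ i, g i = i ∨ g i = i - 1)
    (hA : BddBelow A) : Set.EqOn f g A := by
  obtain ⟨z, hz⟩ := hA
  suffices ∀ n : ℕ, ∀ i ∈ A, i < z + n → f i = g i from
    fun i hi => this (i - z + 1).toNat i hi (by have := hz hi; omega)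
  intro n
  induction n with
  | zero =>
    intro i hi hlt
    have := hz hi
    omega
  | succ n ih =>
    intro i hi hlt
    -- If `f` stays at `i` while `g` drops to `i - 1`, then `f` can reach `i - 1` only from `i - 1`.
    -- By induction `g` agrees with `f` there, so `g` takes the value `i - 1` twice.
    have key : ∀ f g : ℤ → ℤ, Set.BijOn f A B → Set.BijOn g A B → (∀ i, f i = i ∨ f i = i - 1) →
        (∀ i, g i = i ∨ g i = i - 1) → (∀ i ∈ A, i < z + n → f i = g i) →
        f i = i → g i = i - 1 → False := by
      intro f g hf hg hfs hgs ih h1 h2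
      have hm : i - 1 ∈ B := h2 ▸ hg.mapsTo hi
      obtain ⟨k, hk, hki⟩ := hf.surjOn hm
      have hk1 : k = i - 1 := by
        rcases hfs k with h | h
        · omega
        · have : k = i := by omega
          subst this
          omega
      have h3 := ih k hk (by push_cast at hlt; omega)
      have h4 := hg.injOn hk hi (by omega)
      omega
    rcases hfs i with h1 | h1 <;> rcases hgs i with h2 | h2
    · rw [h1, h2]
    · exact (key f g hf hg hfs hgs ih h1 h2).elim
    · exact (key g f hg hf hgs hfs (fun k hk hlt => (ih k hk hlt).symm) h2 h1).elim
    · rw [h1, h2]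

theorem IsLozengeTiling.subset_of_crossings_eq {T' : Set (Finset UnitTriangle)}
    (hb : ∀ s, BddBelow {i | (i, s - i) ∈ ups R}) (hT : IsLozengeTiling R T)
    (hT' : IsLozengeTiling R T') (h : crossings T = crossings T') : T ⊆ T' := by
  intro L hL
  obtain ⟨⟨i, j⟩, q, hpq, rfl⟩ := isLozenge_iff.1 (hT.lozenge L hL)
  by_cases hc : (i, j) ∈ crossings T
  · have := hT.down_unique hL hc
    subst this
    rw [h] at hc
    exact hc
  · obtain ⟨f, hf, hfs, hfT⟩ := hT.isShift (i + j)
    obtain ⟨g, hg, hgs, hgT⟩ := hT'.isShift (i + j)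
    rw [← h] at hg hgT
    have hi : i ∈ freeUps R (crossings T) (i + j) := by
      have e : i + j - i = j := by ring
      exact ⟨by rw [e]; exact hT.mem_ups hL, by rwa [e]⟩
    have hfg := eqOn_of_bijOn_shift hf hg hfs hgs ((hb (i + j)).mono fun k hk => hk.1) hi
    have h1 := hfT i hi
    have h2 := hgT i hi
    rw [hfg] at h1
    rw [add_sub_cancel_left] at h1 h2
    rw [hT.down_unique hL h1]
    exact h2

theorem exists_tiling_of_mem_crossingSets {C : Set (ℤ × ℤ)} (hC : C ∈ crossingSets R) :
    ∃ T, IsLozengeTiling R T ∧ crossings T = C := by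
  classical
  obtain ⟨hCR, hC⟩ := hC
  choose f hf hfs using hC
  -- The matching of the desired tiling: a crossing pairs the two triangles at one position, and
  -- every other triangle follows the shift of its strip.
  set g : ℤ × ℤ → ℤ × ℤ := fun p => if p ∈ C then p else
    (f (p.1 + p.2) p.1, p.1 + p.2 - 1 - f (p.1 + p.2) p.1) with hg
  have hgC : ∀ p ∈ C, g p = p := fun p hp => if_pos hp
  have hgC' : ∀ p ∉ C, g p = (f (p.1 + p.2) p.1, p.1 + p.2 - 1 - f (p.1 + p.2) p.1) :=
    fun p hp => if_neg hp
  have hfree : ∀ p ∈ ups R, p ∉ C → p.1 ∈ freeUps R C (p.1 + p.2) := by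
    rintro ⟨i, j⟩ hp hpC
    have e : i + j - i = j := by ring
    exact ⟨by rw [e]; exact hp, by rwa [e]⟩
  have hmem : ∀ p ∈ ups R, p ∉ C → g p ∈ downs R ∧ g p ∉ C := by
    intro p hp hpC
    rw [hgC' p hpC]
    exact (hf _).mapsTo (hfree p hp hpC)
  have hbij : Set.BijOn g (ups R) (downs R) := by
    refine ⟨?_, ?_, ?_⟩
    · intro p hp
      by_cases hpC : p ∈ C
      · rw [hgC p hpC]
        exact (hCR hpC).2
      · exact (hmem p hp hpC).1
    · intro p hp p' hp' h
      by_cases hpC : p ∈ C <;> by_cases hpC' : p' ∈ C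
      · rwa [hgC p hpC, hgC p' hpC'] at h
      · rw [hgC p hpC] at h
        exact absurd (h ▸ hpC) (hmem p' hp' hpC').2
      · rw [hgC p' hpC'] at h
        exact absurd (h ▸ hpC') (hmem p hp hpC).2
      · rw [hgC' p hpC, hgC' p' hpC'] at h
        simp only [Prod.mk.injEq] at h
        have hs : p.1 + p.2 = p'.1 + p'.2 := by omega
        have h1 := hfree p hp hpC
        have h2 := hfree p' hp' hpC'
        rw [hs] at h1
        have h3 := (hf _).injOn h1 h2 (by rw [← h.1, hs])
        exact Prod.ext h3 (by omega)
    · rintro ⟨k, l⟩ hq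
      by_cases hqC : (k, l) ∈ C
      · exact ⟨(k, l), (hCR hqC).1, hgC _ hqC⟩
      · have e : k + l + 1 - 1 - k = l := by ring
        have hk : k ∈ freeDowns R C (k + l + 1) := ⟨by rw [e]; exact hq, by rwa [e]⟩
        obtain ⟨i, hi, hik⟩ := (hf _).surjOn hk
        refine ⟨(i, k + l + 1 - i), hi.1, ?_⟩
        rw [hgC' _ hi.2]
        have e' : i + (k + l + 1 - i) = k + l + 1 := by ring
        dsimp only
        rw [e', hik, e]
  refine ⟨_, isLozengeTiling_of_bijOn hbij ?_, ?_⟩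
  · intro p
    by_cases hpC : p ∈ C
    · exact Or.inl (hgC p hpC)
    · rw [hgC' p hpC]
      simp only [DownAdj, Prod.ext_iff]
      rcases hfs (p.1 + p.2) p.1 with h | h <;> rw [h] <;> omega
  · ext p
    constructor
    · rintro ⟨p', hp', h⟩
      obtain ⟨rfl, h2⟩ := lozenge_inj.1 h
      by_contra hpC
      rw [hgC' _ hpC] at h2
      have := congrArg Prod.fst h2
      have := congrArg Prod.snd h2
      dsimp only at *
      omega
    · intro hp
      exact ⟨p, (hCR hp).1, by dsimp only; rw [hgC p hp]⟩

/-- Each strip is bounded on one side, so its shift is unique, and a tiling can be recovered from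
its crossings. -/
theorem numLozengeTilings_eq_ncard_crossingSets (hb : ∀ s, BddBelow {i | (i, s - i) ∈ ups R}) :
    numLozengeTilings R = (crossingSets R).ncard := by
  refine Set.ncard_congr (fun T _ => crossings T) ?_ ?_ ?_
  · intro T hT
    exact hT.crossings_mem
  · intro T T' hT hT' h
    exact (hT.subset_of_crossings_eq hb hT' h).antisymm (hT'.subset_of_crossings_eq hb hT h.symm)
  · intro C hC
    obtain ⟨T, hT, h⟩ := exists_tiling_of_mem_crossingSets hC
    exact ⟨T, hT, h⟩

end Tiling

/-! ### Path families as explicit sequences of sets. -/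

/-- The families of nonintersecting lattice paths with `h` steps from `P` to `Q`, as sequences of
finite sets. -/
structure IsPathFamily (P : Finset ℤ) (h : ℕ) (Q : Finset ℤ) (p : ℕ → Finset ℤ) : Prop where
  zero : p 0 = P
  last : p h = Q
  shift : ∀ k < h, IsShift (p (k + 1)) (p k)
  empty : ∀ k, h < k → p k = ∅

theorem exists_finset_isPathFamily (P : Finset ℤ) (h : ℕ) (Q : Finset ℤ) :
    ∃ F : Finset (ℕ → Finset ℤ), (∀ p, p ∈ F ↔ IsPathFamily P h Q p) ∧ #F = pathCount P h Q := by
  classical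
  induction h generalizing Q with
  | zero =>
    by_cases hPQ : P = Q
    · refine ⟨{fun k => if k = 0 then P else ∅}, fun p => ?_, by simp [pathCount, hPQ]⟩
      rw [mem_singleton]
      constructor
      · rintro rfl
        exact ⟨by simp, by simp [hPQ], by simp, fun k hk => if_neg hk.ne'⟩
      · intro hp
        funext k
        rcases Nat.eq_zero_or_pos k with rfl | hk
        · simp [hp.zero]
        · rw [hp.empty k hk, if_neg hk.ne']
    · refine ⟨∅, fun p => ?_, by simp [pathCount, hPQ]⟩
      simp only [notMem_empty, false_iff]
      exact fun hp => hPQ (hp.zero.symm.trans hp.last)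
  | succ h ih =>
    choose F hF hcard using ih
    -- The value at `h + 1`, so far forced to be empty, is overwritten by `Q`. The value at `h` is
    -- still `Q'`, which keeps the united pieces disjoint.
    refine ⟨(shiftPreds Q).biUnion fun Q' => (F Q').image fun p => Function.update p (h + 1) Q,
      fun p => ?_, ?_⟩
    · simp only [mem_biUnion, mem_image, mem_shiftPreds, hF]
      constructor
      · rintro ⟨Q', hQ', p, hp, rfl⟩
        refine ⟨?_, ?_, ?_, ?_⟩
        · rw [Function.update_of_ne (by omega)]
          exact hp.zero
        · rw [Function.update_self]
        · intro k hk
          rw [Function.update_of_ne (a := k) (by omega)]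
          rcases Nat.lt_succ_iff_lt_or_eq.1 hk with hk | rfl
          · rw [Function.update_of_ne (by omega)]
            exact hp.shift k hk
          · rw [Function.update_self, hp.last]
            exact hQ'
        · intro k hk
          rw [Function.update_of_ne (by omega)]
          exact hp.empty k (by omega)
      · intro hp
        refine ⟨p h, hp.last ▸ hp.shift h (by omega), Function.update p (h + 1) ∅,
          ⟨?_, ?_, ?_, ?_⟩, ?_⟩
        · rw [Function.update_of_ne (by omega)]
          exact hp.zero
        · rw [Function.update_of_ne (by omega)]
        · intro k hk
          rw [Function.update_of_ne (by omega), Function.update_of_ne (by omega)]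
          exact hp.shift k (by omega)
        · intro k hk
          by_cases hk' : k = h + 1
          · rw [hk', Function.update_self]
          · rw [Function.update_of_ne hk']
            exact hp.empty k (by omega)
        · rw [Function.update_idem, ← hp.last, Function.update_eq_self]
    · rw [card_biUnion, pathCount]
      · refine sum_congr rfl fun Q' _ => ?_
        rw [card_image_of_injOn, hcard]
        intro p hp p' hp' hpp
        have hp := (hF _ _).1 hp
        have hp' := (hF _ _).1 hp'
        funext k
        by_cases hk : k = h + 1
        · rw [hk, hp.empty _ (by omega), hp'.empty _ (by omega)]
        · have := congrFun hpp k
          simpa [Function.update_of_ne hk] using this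
      · intro Q₁ _ Q₂ _ hne
        refine disjoint_left.2 fun p hp₁ hp₂ => hne ?_
        obtain ⟨p₁, h₁, rfl⟩ := mem_image.1 hp₁
        obtain ⟨p₂, h₂, h₃⟩ := mem_image.1 hp₂
        have := congrFun h₃ h
        rw [Function.update_of_ne (by omega), Function.update_of_ne (by omega)] at this
        rw [← ((hF _ _).1 h₁).last, ← ((hF _ _).1 h₂).last, this]

namespace IsPathFamily

variable {P Q : Finset ℤ} {h : ℕ} {p : ℕ → Finset ℤ}

/-- Carries an invariant that survives both kinds of step. Together with `backward` it is used to
show that paths with the right ends stay inside the region. -/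
theorem forward (hp : IsPathFamily P h Q p) (Φ : ℕ → ℤ → Prop) (h0 : ∀ i ∈ P, Φ 0 i)
    (hΦ : ∀ k i, Φ k i → Φ (k + 1) i ∧ Φ (k + 1) (i + 1)) {k : ℕ} (hk : k ≤ h) {i : ℤ}
    (hi : i ∈ p k) : Φ k i := by
  induction k generalizing i with
  | zero => exact h0 i (hp.zero ▸ hi)
  | succ k ih =>
    rcases (hp.shift k hk).exists_pred (mem_coe.2 hi) with h' | h'
    · exact (hΦ k i (ih (by omega) h')).1
    · have := (hΦ k _ (ih (by omega) h')).2
      rwa [sub_add_cancel] at this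

theorem backward (hp : IsPathFamily P h Q p) (Φ : ℕ → ℤ → Prop) (h0 : ∀ i ∈ Q, Φ h i)
    (hΦ : ∀ k i, Φ (k + 1) i → Φ k i ∧ Φ k (i - 1)) {k : ℕ} (hk : k ≤ h) {i : ℤ}
    (hi : i ∈ p k) : Φ k i := by
  obtain ⟨d, rfl⟩ := Nat.exists_eq_add_of_le hk
  induction d generalizing k i with
  | zero => exact h0 i (hp.last ▸ hi)
  | succ d ih =>
    have e : k + 1 + d = k + (d + 1) := by ring
    have ih' := @ih (k + 1)
    rw [e] at ih'
    rcases (hp.shift k (by omega)).exists_succ (mem_coe.2 hi) with h' | h'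
    · exact (hΦ k i (ih' h' hp h0 (by omega))).1
    · have := (hΦ k _ (ih' h' hp h0 (by omega))).2
      rwa [add_sub_cancel_right] at this

end IsPathFamily

/-! ### The magnet bar region as pairs of path families. -/

section MagnetBar

variable {x y a b c m : ℕ}

theorem mem_ups_magnetBarRegion {i j : ℤ} : (i, j) ∈ ups (magnetBarRegion x y a b c m) ↔
    (0 ≤ i ∧ i < x + y + c + m ∧ -(y + c : ℤ) ≤ j ∧ j < a + b + m ∧ 0 ≤ i + j ∧
      i + j < x + c + a + b + m) ∧ ¬ (b ≤ j ∧ i + j < b + m) ∧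
      ¬ (i < m + c ∧ j < b ∧ b + m ≤ i + j) := by
  simp only [ups, magnetBarRegion, UnitTriangle.In, UnitTriangle.vertices, outerHexagon, upTriangle,
    downTriangle, Set.mem_ofPred_eq, if_true, mem_insert, mem_singleton, forall_eq_or_imp, forall_eq]
  omega

theorem mem_downs_magnetBarRegion {i j : ℤ} : (i, j) ∈ downs (magnetBarRegion x y a b c m) ↔
    (0 ≤ i ∧ i < x + y + c + m ∧ -(y + c : ℤ) ≤ j ∧ j < a + b + m ∧ -1 ≤ i + j ∧
      i + j + 1 < x + c + a + b + m) ∧ ¬ (b ≤ j ∧ i + j + 1 < b + m) ∧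
      ¬ (i < m + c ∧ j < b ∧ b + m ≤ i + j + 1) := by
  simp only [downs, magnetBarRegion, UnitTriangle.In, UnitTriangle.vertices, outerHexagon,
    upTriangle, downTriangle, Set.mem_ofPred_eq, Bool.false_eq_true, if_false, mem_insert,
    mem_singleton, forall_eq_or_imp, forall_eq]
  omega

/-- A pair of path families, below and above the line through the right side of the up-pointing
triangle and the left side of the down-pointing triangle, that meets this line in the set `Q`
outside of these sides. -/
def IsMagnetPaths (x y a b c m : ℕ) (Q : Finset ℤ) (p p' : ℕ → Finset ℤ) : Prop :=
  IsPathFamily (Ico 0 ((y + c : ℕ) : ℤ)) (b + m) (Ico (m : ℤ) (m + c) ∪ Q) p ∧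
    IsPathFamily (Ico 0 (m : ℤ) ∪ Q) (x + c + a)
      (Ico ((x + c : ℕ) : ℤ) ((x + c : ℕ) + (y + m : ℕ))) p'

/-- The crossing lozenges of the tiling that belongs to a pair of path families. -/
def magnetCrossings (x y a b c m : ℕ) (p p' : ℕ → Finset ℤ) : Set (ℤ × ℤ) :=
  {q | q ∈ ups (magnetBarRegion x y a b c m) ∧ q ∈ downs (magnetBarRegion x y a b c m) ∧
    (∀ k : ℕ, q.1 + q.2 + 1 = k → k ≤ b + m → q.1 ∉ p k) ∧
    ∀ k : ℕ, q.1 + q.2 + 1 = b + m + k → q.1 ∉ p' k}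

section Paths

variable {Q : Finset ℤ} {p p' : ℕ → Finset ℤ}

/-- The ends alone confine the lower paths to the region. The last bound, propagated back from the
cutting line, keeps them out of the up-pointing hole. -/
theorem IsMagnetPaths.lower_bounds (hp : IsMagnetPaths x y a b c m Q p p')
    (hQ : Q ⊆ Ico (m + c : ℤ) (m + c + y + b)) {k : ℕ} (hk : k ≤ b + m) {i : ℤ} (hi : i ∈ p k) :
    0 ≤ i ∧ i < y + c + k ∧ i < x + y + c + m ∧ (k : ℤ) - b ≤ i := by
  obtain ⟨hp, hp'⟩ := hp
  refine ⟨?_, ?_, ?_, ?_⟩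
  · refine hp.forward (fun _ i => 0 ≤ i) (fun i hi => (mem_Ico.1 hi).1) ?_ hk hi
    intro k i h; omega
  · refine hp.forward (fun k i => i < y + c + k) ?_ ?_ hk hi
    · intro i hi; have := mem_Ico.1 hi; push_cast at *; omega
    · intro k i h; push_cast; omega
  · refine hp.backward (fun _ i => i < x + y + c + m) ?_ ?_ hk hi
    · intro i hi
      rcases mem_union.1 hi with hi | hi
      · have := mem_Ico.1 hi; omega
      · refine hp'.backward (fun _ i => i < x + y + c + m) ?_ ?_ (Nat.zero_le _)
          (hp'.zero ▸ mem_union_right _ hi)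
        · intro i hi; have := mem_Ico.1 hi; push_cast at *; omega
        · intro k i h; omega
    · intro k i h; omega
  · refine hp.backward (fun k i => (k : ℤ) - b ≤ i) ?_ ?_ hk hi
    · intro i hi
      rcases mem_union.1 hi with hi | hi
      · have := mem_Ico.1 hi; push_cast; omega
      · have := mem_Ico.1 (hQ hi); push_cast; omega
    · intro k i h; push_cast at h; omega

/-- Here the final alternative keeps the paths out of the down-pointing hole: those from `[0, m)`
pass on its left, those from `Q` on its right. -/
theorem IsMagnetPaths.upper_bounds (hp : IsMagnetPaths x y a b c m Q p p')
    (hQ : Q ⊆ Ico (m + c : ℤ) (m + c + y + b)) {k : ℕ} (hk : k ≤ x + c + a) {i : ℤ}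
    (hi : i ∈ p' k) :
    0 ≤ i ∧ i < y + c + b + m + k ∧ i < x + y + c + m ∧ (k : ℤ) - a ≤ i ∧
      (i < m + k ∨ m + c ≤ i) := by
  obtain ⟨-, hp'⟩ := hp
  refine ⟨?_, ?_, ?_, ?_, ?_⟩
  · refine hp'.forward (fun _ i => 0 ≤ i) ?_ ?_ hk hi
    · intro i hi
      rcases mem_union.1 hi with hi | hi
      · exact (mem_Ico.1 hi).1
      · have := mem_Ico.1 (hQ hi); omega
    · intro k i h; omega
  · refine hp'.forward (fun k i => i < y + c + b + m + k) ?_ ?_ hk hi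
    · intro i hi
      rcases mem_union.1 hi with hi | hi
      · have := mem_Ico.1 hi; push_cast; omega
      · have := mem_Ico.1 (hQ hi); push_cast; omega
    · intro k i h; push_cast; omega
  · refine hp'.backward (fun _ i => i < x + y + c + m) ?_ ?_ hk hi
    · intro i hi; have := mem_Ico.1 hi; push_cast at *; omega
    · intro k i h; omega
  · refine hp'.backward (fun k i => (k : ℤ) - a ≤ i) ?_ ?_ hk hi
    · intro i hi; have := mem_Ico.1 hi; push_cast at *; omega
    · intro k i h; push_cast at h; omega
  · refine hp'.forward (fun k i => i < m + k ∨ (m + c : ℤ) ≤ i) ?_ ?_ hk hi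
    · intro i hi
      rcases mem_union.1 hi with hi | hi
      · have := mem_Ico.1 hi; omega
      · have := mem_Ico.1 (hQ hi); omega
    · intro k i h; push_cast; omega

theorem mem_magnetCrossings_iff {i : ℤ} {k : ℤ} {j : ℤ} (hj : j = k - 1 - i) :
    (i, j) ∈ magnetCrossings x y a b c m p p' ↔
      (i, k - 1 - i) ∈ ups (magnetBarRegion x y a b c m) ∧
        (i, k - 1 - i) ∈ downs (magnetBarRegion x y a b c m) ∧
        (∀ l : ℕ, k = l → l ≤ b + m → i ∉ p l) ∧ ∀ l : ℕ, k = b + m + l → i ∉ p' l := by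
  subst hj
  have e : i + (k - 1 - i) + 1 = k := by ring
  simp only [magnetCrossings, Set.mem_ofPred_eq, e]

/-- This and the next three lemmas recover the paths from the crossings on either side of each line.
-/
theorem IsMagnetPaths.freeUps_lower (hp : IsMagnetPaths x y a b c m Q p p')
    (hQ : Q ⊆ Ico (m + c : ℤ) (m + c + y + b)) {k : ℕ} (hk : 1 ≤ k) (hk' : k ≤ b + m) :
    freeUps (magnetBarRegion x y a b c m) (magnetCrossings x y a b c m p p') ((k : ℤ) - 1) =
      p k := by
  ext i
  rw [freeUps, Set.mem_ofPred_eq, mem_magnetCrossings_iff (k := k) rfl, mem_coe]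
  constructor
  · rintro ⟨hu, hC⟩
    by_contra hi
    apply hC
    refine ⟨hu, ?_, ?_, ?_⟩
    · rw [mem_ups_magnetBarRegion] at hu
      rw [mem_downs_magnetBarRegion]
      rcases hk'.eq_or_lt with rfl | hlt
      · have hlast := hp.1.last
        -- In this degenerate case the cutting line is the northeastern side of the hexagon and no
        -- triangle of the region lies beyond it. The upper family then has no steps, which forces
        -- `Q`.
        by_cases hl : x + c + a = 0
        · exfalso
          have h0 := hp.2.zero
          have hl' := hp.2.last
          rw [hl] at hl'
          rw [h0] at hl'
          rw [hlast] at hi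
          apply hi
          have hi' : i ∈ Ico 0 (m : ℤ) ∪ Q := by
            rw [hl', mem_Ico]
            push_cast at *
            omega
          rcases mem_union.1 hi' with h | h
          · have := mem_Ico.1 h
            push_cast at *
            omega
          · exact mem_union_right _ h
        · have hi1 : ¬ ((m : ℤ) ≤ i ∧ i < m + c) := fun h => hi (by
            rw [hlast]
            exact mem_union_left _ (mem_Ico.2 h))
          push_cast at *
          omega
      · omega
    · intro l hl _
      rwa [← Int.ofNat_inj.1 hl]
    · intro l hl
      obtain rfl : l = 0 := by omega
      obtain rfl : k = b + m := by omega
      rw [hp.2.zero]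
      intro hi'
      rcases mem_union.1 hi' with h | h
      · have := mem_Ico.1 h
        rw [mem_ups_magnetBarRegion] at hu
        push_cast at *
        omega
      · exact hi (hp.1.last ▸ mem_union_right _ h)
  · intro hi
    refine ⟨?_, fun hC => hC.2.2.1 k rfl hk' hi⟩
    have := hp.lower_bounds hQ hk' hi
    rw [mem_ups_magnetBarRegion]
    omega

theorem IsMagnetPaths.freeDowns_lower (hp : IsMagnetPaths x y a b c m Q p p')
    (hQ : Q ⊆ Ico (m + c : ℤ) (m + c + y + b)) {k : ℕ} (hk : k < b + m) :
    freeDowns (magnetBarRegion x y a b c m) (magnetCrossings x y a b c m p p') k = p k := by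
  ext i
  rw [freeDowns, Set.mem_ofPred_eq, mem_magnetCrossings_iff (k := k) rfl, mem_coe]
  constructor
  · rintro ⟨hd, hC⟩
    by_contra hi
    apply hC
    rw [mem_downs_magnetBarRegion] at hd
    refine ⟨?_, mem_downs_magnetBarRegion.2 hd, ?_, ?_⟩
    · rw [mem_ups_magnetBarRegion]
      rcases Nat.eq_zero_or_pos k with rfl | hk0
      · exfalso
        rw [hp.1.zero, mem_Ico] at hi
        push_cast at *
        omega
      · omega
    · intro l hl _
      rwa [← Int.ofNat_inj.1 hl]
    · intro l hl
      omega
  · intro hi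
    refine ⟨?_, fun hC => hC.2.2.1 k rfl hk.le hi⟩
    have := hp.lower_bounds hQ hk.le hi
    rw [mem_downs_magnetBarRegion]
    omega

theorem IsMagnetPaths.freeDowns_upper (hp : IsMagnetPaths x y a b c m Q p p')
    (hQ : Q ⊆ Ico (m + c : ℤ) (m + c + y + b)) {k : ℕ} (hk : k < x + c + a) :
    freeDowns (magnetBarRegion x y a b c m) (magnetCrossings x y a b c m p p') (b + m + k) =
      p' k := by
  ext i
  rw [freeDowns, Set.mem_ofPred_eq, mem_magnetCrossings_iff (k := b + m + k) rfl, mem_coe]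
  constructor
  · rintro ⟨hd, hC⟩
    by_contra hi
    apply hC
    rw [mem_downs_magnetBarRegion] at hd
    refine ⟨?_, mem_downs_magnetBarRegion.2 hd, ?_, ?_⟩
    · rw [mem_ups_magnetBarRegion]
      rcases Nat.eq_zero_or_pos k with rfl | hk0
      · rw [hp.2.zero] at hi
        -- The opposite degenerate case: the cutting line is the southwestern side, and the lower
        -- family has no steps.
        by_cases hl : b + m = 0
        · exfalso
          have h0 := hp.1.zero
          have hl' := hp.1.last
          rw [hl, h0] at hl'
          apply hi
          have hi' : i ∈ Ico (m : ℤ) (m + c) ∪ Q := by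
            rw [← hl', mem_Ico]
            push_cast at *
            omega
          rcases mem_union.1 hi' with h | h
          · have := mem_Ico.1 h
            push_cast at *
            omega
          · exact mem_union_right _ h
        · have hi1 : ¬ (0 ≤ i ∧ i < m) := fun h => hi (mem_union_left _ (mem_Ico.2 h))
          push_cast at *
          omega
      · omega
    · intro l hl hl'
      obtain rfl : k = 0 := by omega
      obtain rfl : l = b + m := by omega
      rw [hp.1.last]
      intro hi'
      rcases mem_union.1 hi' with h | h
      · have := mem_Ico.1 h
        push_cast at *
        omega
      · exact hi (hp.2.zero ▸ mem_union_right _ h)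
    · intro l hl
      obtain rfl : l = k := by omega
      exact hi
  · intro hi
    refine ⟨?_, fun hC => hC.2.2.2 k rfl hi⟩
    have := hp.upper_bounds hQ hk.le hi
    rw [mem_downs_magnetBarRegion]
    omega

theorem IsMagnetPaths.freeUps_upper (hp : IsMagnetPaths x y a b c m Q p p')
    (hQ : Q ⊆ Ico (m + c : ℤ) (m + c + y + b)) {k : ℕ} (hk : 1 ≤ k) (hk' : k ≤ x + c + a) :
    freeUps (magnetBarRegion x y a b c m) (magnetCrossings x y a b c m p p') (b + m + k - 1) =
      p' k := by
  ext i
  rw [freeUps, Set.mem_ofPred_eq, mem_magnetCrossings_iff (k := b + m + k) rfl, mem_coe]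
  constructor
  · rintro ⟨hu, hC⟩
    by_contra hi
    apply hC
    rw [mem_ups_magnetBarRegion] at hu
    refine ⟨mem_ups_magnetBarRegion.2 hu, ?_, ?_, ?_⟩
    · rw [mem_downs_magnetBarRegion]
      rcases hk'.eq_or_lt with rfl | hlt
      · exfalso
        rw [hp.2.last, mem_Ico] at hi
        push_cast at *
        omega
      · omega
    · intro l hl hl'
      omega
    · intro l hl
      obtain rfl : l = k := by omega
      exact hi
  · intro hi
    refine ⟨?_, fun hC => hC.2.2.2 k rfl hi⟩
    have := hp.upper_bounds hQ hk' hi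
    rw [mem_ups_magnetBarRegion]
    omega

theorem isShift_empty : IsShift ∅ ∅ := ⟨id, Set.bijOn_id _, fun _ => Or.inl rfl⟩

theorem IsMagnetPaths.magnetCrossings_mem (hp : IsMagnetPaths x y a b c m Q p p')
    (hQ : Q ⊆ Ico (m + c : ℤ) (m + c + y + b)) :
    magnetCrossings x y a b c m p p' ∈ crossingSets (magnetBarRegion x y a b c m) := by
  refine ⟨fun q hq => ⟨hq.1, hq.2.1⟩, fun s => ?_⟩
  by_cases hs : 0 ≤ s ∧ s < x + c + a + b + m
  · obtain ⟨k, rfl⟩ := Int.eq_ofNat_of_zero_le hs.1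
    rcases lt_or_ge k (b + m) with hk | hk
    · rw [hp.freeDowns_lower hQ hk]
      have := hp.freeUps_lower hQ (k := k + 1) (by omega) (by omega)
      rw [Nat.cast_succ, add_sub_cancel_right] at this
      rw [this]
      exact hp.1.shift k hk
    · obtain ⟨l, rfl⟩ := Nat.exists_eq_add_of_le hk
      have hl : l < x + c + a := by push_cast at hs; omega
      have h1 := hp.freeDowns_upper hQ hl
      have h2 := hp.freeUps_upper hQ (k := l + 1) (by omega) (by omega)
      rw [Nat.cast_succ, ← add_assoc, add_sub_cancel_right] at h2
      push_cast
      rw [h1, h2]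
      exact hp.2.shift l hl
  · have h1 : freeUps (magnetBarRegion x y a b c m) (magnetCrossings x y a b c m p p') s = ∅ := by
      refine Set.eq_empty_of_forall_notMem fun i hi => ?_
      have := mem_ups_magnetBarRegion.1 hi.1
      omega
    have h2 : freeDowns (magnetBarRegion x y a b c m) (magnetCrossings x y a b c m p p') s =
        ∅ := by
      refine Set.eq_empty_of_forall_notMem fun i hi => ?_
      have := mem_downs_magnetBarRegion.1 hi.1
      omega
    rw [h1, h2]
    exact isShift_empty

theorem IsMagnetPaths.eq_of_magnetCrossings_eq {Q₁ Q₂ : Finset ℤ} {p₁ p₁' p₂ p₂' : ℕ → Finset ℤ}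
    (hp₁ : IsMagnetPaths x y a b c m Q₁ p₁ p₁') (hp₂ : IsMagnetPaths x y a b c m Q₂ p₂ p₂')
    (hQ₁ : Q₁ ⊆ Ico (m + c : ℤ) (m + c + y + b)) (hQ₂ : Q₂ ⊆ Ico (m + c : ℤ) (m + c + y + b))
    (h : magnetCrossings x y a b c m p₁ p₁' = magnetCrossings x y a b c m p₂ p₂') :
    p₁ = p₂ ∧ p₁' = p₂' := by
  constructor
  · funext k
    rcases Nat.eq_zero_or_pos k with rfl | hk
    · rw [hp₁.1.zero, hp₂.1.zero]
    rcases le_or_gt k (b + m) with hk' | hk'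
    · rw [← coe_inj, ← hp₁.freeUps_lower hQ₁ hk hk', ← hp₂.freeUps_lower hQ₂ hk hk', h]
    · rw [hp₁.1.empty k hk', hp₂.1.empty k hk']
  · funext k
    rcases lt_trichotomy k (x + c + a) with hk | rfl | hk
    · rw [← coe_inj, ← hp₁.freeDowns_upper hQ₁ hk, ← hp₂.freeDowns_upper hQ₂ hk, h]
    · rw [hp₁.2.last, hp₂.2.last]
    · rw [hp₁.2.empty k hk, hp₂.2.empty k hk]

end Paths

open Classical in
theorem exists_isMagnetPaths {C : Set (ℤ × ℤ)}
    (hC : C ∈ crossingSets (magnetBarRegion x y a b c m)) :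
    ∃ Q ⊆ Ico (m + c : ℤ) (m + c + y + b), ∃ p p', IsMagnetPaths x y a b c m Q p p' ∧
      magnetCrossings x y a b c m p p' = C := by
  obtain ⟨hCR, hC⟩ := hC
  set R := magnetBarRegion x y a b c m
  have hCu : ∀ {i j : ℤ}, (i, j) ∈ C → (i, j) ∈ ups R := fun h => (hCR h).1
  have hCd : ∀ {i j : ℤ}, (i, j) ∈ C → (i, j) ∈ downs R := fun h => (hCR h).2
  -- `p` reads each line from below and `p'` reads it from above, which matters on the cutting line,
  -- where the two readings differ. On the first and the last line there is no triangle of the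
  -- region on the side being read, so the value is prescribed.
  set p : ℕ → Finset ℤ := fun k => if k = 0 then Ico 0 ((y + c : ℕ) : ℤ) else
    if k ≤ b + m then (Ico (0 : ℤ) (x + y + c + m)).filter (· ∈ freeUps R C ((k : ℤ) - 1))
    else ∅ with hp
  set p' : ℕ → Finset ℤ := fun k => if k = x + c + a then
      Ico ((x + c : ℕ) : ℤ) ((x + c : ℕ) + (y + m : ℕ)) else
    if k < x + c + a then (Ico (0 : ℤ) (x + y + c + m)).filter (· ∈ freeDowns R C (b + m + k))
    else ∅ with hp'
  have hp0 : p 0 = Ico 0 ((y + c : ℕ) : ℤ) := if_pos rfl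
  have hpk : ∀ k, 1 ≤ k → k ≤ b + m → ∀ i, i ∈ p k ↔ i ∈ freeUps R C ((k : ℤ) - 1) := by
    intro k hk hk' i
    simp only [hp]
    rw [if_neg (by omega), if_pos hk', mem_filter, and_iff_right_iff_imp, mem_Ico]
    intro hi
    have := mem_ups_magnetBarRegion.1 hi.1
    omega
  have hpl : p' (x + c + a) = Ico ((x + c : ℕ) : ℤ) ((x + c : ℕ) + (y + m : ℕ)) := if_pos rfl
  have hpk' : ∀ k, k < x + c + a → ∀ i, i ∈ p' k ↔ i ∈ freeDowns R C (b + m + k) := by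
    intro k hk i
    simp only [hp']
    rw [if_neg (by omega), if_pos hk, mem_filter, and_iff_right_iff_imp, mem_Ico]
    intro hi
    have := mem_downs_magnetBarRegion.1 hi.1
    omega
  have hdown : ∀ k < b + m, freeDowns R C k = p k := by
    intro k hk
    ext i
    rw [mem_coe]
    rcases Nat.eq_zero_or_pos k with rfl | hk0
    · rw [hp0, mem_Ico]
      constructor
      · intro hi
        have := mem_downs_magnetBarRegion.1 hi.1
        push_cast at *
        omega
      · intro hi
        refine ⟨mem_downs_magnetBarRegion.2 ?_, fun h => ?_⟩
        · push_cast at *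
          omega
        · have := mem_ups_magnetBarRegion.1 (hCu h)
          push_cast at *
          omega
    · rw [hpk k hk0 hk.le]
      simp only [freeUps, freeDowns, Set.mem_ofPred_eq]
      refine and_congr_left fun _ => ?_
      rw [mem_ups_magnetBarRegion, mem_downs_magnetBarRegion]
      omega
  have hup : ∀ k, 1 ≤ k → k ≤ x + c + a → freeUps R C (b + m + k - 1) = p' k := by
    intro k hk hk'
    ext i
    rw [mem_coe]
    rcases hk'.eq_or_lt with rfl | hlt
    · rw [hpl, mem_Ico]
      constructor
      · intro hi
        have := mem_ups_magnetBarRegion.1 hi.1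
        push_cast at *
        omega
      · intro hi
        refine ⟨mem_ups_magnetBarRegion.2 ?_, fun h => ?_⟩
        · push_cast at *
          omega
        · have := mem_downs_magnetBarRegion.1 (hCd h)
          push_cast at *
          omega
    · rw [hpk' k hlt]
      simp only [freeUps, freeDowns, Set.mem_ofPred_eq]
      refine and_congr_left fun _ => ?_
      rw [mem_ups_magnetBarRegion, mem_downs_magnetBarRegion]
      omega
  -- On the cutting line each hole leaves triangles on one side without a partner across: `[m, m +
  -- c)` is occupied only from below and `[0, m)` only from above. From `m + c` on, the two readings
  -- agree, and this common part is `Q`.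
  have hmid : ∀ i, (i ∈ p (b + m) ↔ (m ≤ i ∧ i < m + c) ∨ (m + c ≤ i ∧ i ∈ p (b + m))) ∧
      (i ∈ p' 0 ↔ (0 ≤ i ∧ i < m) ∨ (m + c ≤ i ∧ i ∈ p (b + m))) ∧
      (i ∈ p (b + m) → i < m + c + y + b) := by
    intro i
    have h1 : i ∈ p (b + m) ↔ (b + m = 0 ∧ 0 ≤ i ∧ i < y + c) ∨
        (0 < b + m ∧ (i, ((b : ℤ) + m) - 1 - i) ∈ ups R ∧ (i, ((b : ℤ) + m) - 1 - i) ∉ C) := by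
      rcases Nat.eq_zero_or_pos (b + m) with h | h
      · rw [h, hp0, mem_Ico]
        simp
      · rw [hpk _ h le_rfl]
        simp only [freeUps, Set.mem_ofPred_eq, Nat.cast_add]
        simp only [eq_false (show ¬ b + m = 0 by omega), eq_true (show 0 < b + m from h),
          false_and, true_and, false_or]
    have h2 : i ∈ p' 0 ↔ (x + c + a = 0 ∧ 0 ≤ i ∧ i < y + m) ∨
        (0 < x + c + a ∧ (i, ((b : ℤ) + m) - 1 - i) ∈ downs R ∧
          (i, ((b : ℤ) + m) - 1 - i) ∉ C) := by
      rcases Nat.eq_zero_or_pos (x + c + a) with h | h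
      · rw [← h, hpl, mem_Ico]
        push_cast
        omega
      · rw [hpk' _ h]
        simp only [freeDowns, Set.mem_ofPred_eq, Nat.cast_zero, add_zero]
        simp only [eq_false (show ¬ x + c + a = 0 by omega), eq_true (show 0 < x + c + a from h),
          false_and, true_and, false_or]
    have h3 := @hCu i ((b : ℤ) + m - 1 - i)
    have h4 := @hCd i ((b : ℤ) + m - 1 - i)
    rw [h1, h2]
    rw [mem_ups_magnetBarRegion] at h3 ⊢
    rw [mem_downs_magnetBarRegion] at h4 ⊢
    by_cases hC' : (i, (b : ℤ) + m - 1 - i) ∈ C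
    · have h3 := h3 hC'
      have h4 := h4 hC'
      simp only [hC', not_true, and_false, or_false]
      omega
    · simp only [hC', not_false_iff, and_true]
      omega
  refine ⟨(p (b + m)).filter fun i => (m + c : ℤ) ≤ i, ?_, p, p', ⟨⟨hp0, ?_, ?_, ?_⟩,
    ⟨?_, hpl, ?_, ?_⟩⟩, ?_⟩
  · intro i hi
    rw [mem_filter] at hi
    exact mem_Ico.2 ⟨hi.2, (hmid i).2.2 hi.1⟩
  · ext i
    rw [mem_union, mem_Ico, mem_filter, and_comm (a := i ∈ p (b + m))]
    exact (hmid i).1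
  · intro k hk
    have h1 := hC k
    rw [hdown k hk] at h1
    have h2 : (p (k + 1) : Set ℤ) = freeUps R C k := by
      ext i
      rw [mem_coe, hpk (k + 1) (by omega) (by omega), Nat.cast_succ, add_sub_cancel_right]
    rwa [h2]
  · intro k hk
    simp only [hp]
    rw [if_neg (by omega), if_neg (by omega)]
  · ext i
    rw [mem_union, mem_Ico, mem_filter, and_comm (a := i ∈ p (b + m))]
    exact (hmid i).2.1
  · intro k hk
    have h1 := hC (b + m + k)
    have h3 := hup (k + 1) (by omega) (by omega)
    rw [Nat.cast_succ, ← add_assoc, add_sub_cancel_right] at h3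
    rw [h3] at h1
    have h2 : (p' k : Set ℤ) = freeDowns R C (b + m + k) := by
      ext i
      rw [mem_coe, hpk' k hk]
    rwa [h2]
  · intro k hk
    simp only [hp']
    rw [if_neg (by omega), if_neg (by omega)]
  · ext ⟨i, j⟩
    constructor
    · rintro ⟨hu, hd, h1, h2⟩
      by_contra hijC
      have hu' := mem_ups_magnetBarRegion.1 hu
      have hd' := mem_downs_magnetBarRegion.1 hd
      dsimp only at h1 h2
      rcases le_or_gt (i + j + 1) (b + m) with hk | hk
      · obtain ⟨k, hk'⟩ := Int.eq_ofNat_of_zero_le (a := i + j + 1) (by omega)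
        apply h1 k hk' (by omega)
        rw [hpk k (by omega) (by omega)]
        have e : (k : ℤ) - 1 - i = j := by omega
        simp only [freeUps, Set.mem_ofPred_eq, e]
        exact ⟨hu, hijC⟩
      · obtain ⟨k, hk'⟩ := Int.eq_ofNat_of_zero_le (a := i + j + 1 - (b + m)) (by omega)
        apply h2 k (by omega)
        rw [hpk' k (by omega)]
        have e : (b + m + k : ℤ) - 1 - i = j := by omega
        simp only [freeDowns, Set.mem_ofPred_eq, e]
        exact ⟨hd, hijC⟩
    · intro hij
      refine ⟨hCu hij, hCd hij, ?_, ?_⟩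
      · intro k hk hk'
        dsimp only at hk ⊢
        have hu' := mem_ups_magnetBarRegion.1 (hCu hij)
        rw [hpk k (by omega) hk']
        have e : (k : ℤ) - 1 - i = j := by omega
        simp only [freeUps, Set.mem_ofPred_eq, e]
        exact fun h => h.2 hij
      · intro k hk
        dsimp only at hk ⊢
        have hd' := mem_downs_magnetBarRegion.1 (hCd hij)
        rw [hpk' k (by omega)]
        have e : (b + m + k : ℤ) - 1 - i = j := by omega
        simp only [freeDowns, Set.mem_ofPred_eq, e]
        exact fun h => h.2 hij

/-- The tilings of the magnet bar region as pairs of families of nonintersecting lattice paths. -/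
theorem numLozengeTilings_magnetBarRegion_eq_sum (x y a b c m : ℕ) :
    numLozengeTilings (magnetBarRegion x y a b c m) =
      ∑ Q ∈ (Ico (m + c : ℤ) (m + c + y + b)).powerset,
        pathCount (Ico 0 ((y + c : ℕ) : ℤ)) (b + m) (Ico (m : ℤ) (m + c) ∪ Q) *
        pathCount (Ico 0 (m : ℤ) ∪ Q) (x + c + a)
          (Ico ((x + c : ℕ) : ℤ) ((x + c : ℕ) + (y + m : ℕ))) := by
  classical
  rw [numLozengeTilings_eq_ncard_crossingSets]
  swap
  · intro s
    refine ⟨0, fun i hi => ?_⟩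
    have := mem_ups_magnetBarRegion.1 hi
    omega
  choose F hF hFcard using exists_finset_isPathFamily
  set G : Finset ((_ : Finset ℤ) × (ℕ → Finset ℤ) × (ℕ → Finset ℤ)) :=
    (Ico (m + c : ℤ) (m + c + y + b)).powerset.sigma fun Q =>
      F (Ico 0 ((y + c : ℕ) : ℤ)) (b + m) (Ico (m : ℤ) (m + c) ∪ Q) ×ˢ
      F (Ico 0 (m : ℤ) ∪ Q) (x + c + a)
        (Ico ((x + c : ℕ) : ℤ) ((x + c : ℕ) + (y + m : ℕ))) with hG
  have hmem : ∀ g : (_ : Finset ℤ) × (ℕ → Finset ℤ) × (ℕ → Finset ℤ),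
      g ∈ (G : Set _) ↔ g.1 ⊆ Ico (m + c : ℤ) (m + c + y + b) ∧
      IsMagnetPaths x y a b c m g.1 g.2.1 g.2.2 := by
    intro g
    simp only [hG, mem_coe, mem_sigma, mem_powerset, mem_product, hF, IsMagnetPaths]
  have hcard : #G = ∑ Q ∈ (Ico (m + c : ℤ) (m + c + y + b)).powerset,
      pathCount (Ico 0 ((y + c : ℕ) : ℤ)) (b + m) (Ico (m : ℤ) (m + c) ∪ Q) *
      pathCount (Ico 0 (m : ℤ) ∪ Q) (x + c + a)
        (Ico ((x + c : ℕ) : ℤ) ((x + c : ℕ) + (y + m : ℕ))) := by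
    simp only [hG, card_sigma, card_product, hFcard]
  rw [← hcard, ← Set.ncard_coe_finset]
  symm
  refine Set.ncard_congr (fun g _ => magnetCrossings x y a b c m g.2.1 g.2.2) ?_ ?_ ?_
  · intro g hg
    obtain ⟨hQ, hg⟩ := (hmem g).1 hg
    exact hg.magnetCrossings_mem hQ
  · rintro ⟨Q₁, p₁, p₁'⟩ ⟨Q₂, p₂, p₂'⟩ h₁ h₂ h
    obtain ⟨hQ₁, h₁⟩ := (hmem _).1 h₁
    obtain ⟨hQ₂, h₂⟩ := (hmem _).1 h₂
    dsimp only at *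
    obtain ⟨rfl, rfl⟩ := h₁.eq_of_magnetCrossings_eq h₂ hQ₁ hQ₂ h
    -- `Q` is determined by the lower family, whose final set is the disjoint union of `[m, m + c)`
    -- and `Q`.
    have hu := h₁.1.last.symm.trans h₂.1.last
    have hd : ∀ Q ⊆ Ico (m + c : ℤ) (m + c + y + b), Disjoint (Ico (m : ℤ) (m + c)) Q := by
      intro Q hQ
      refine disjoint_left.2 fun i hi hi' => ?_
      have h1 := mem_Ico.1 hi
      have h2 := mem_Ico.1 (hQ hi')
      omega
    have hQ : Q₁ = Q₂ := by
      rw [← union_sdiff_cancel_left (hd Q₁ hQ₁), hu, union_sdiff_cancel_left (hd Q₂ hQ₂)]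
    subst hQ
    rfl
  · intro C hC
    obtain ⟨Q, hQ, p, p', hp, hpC⟩ := exists_isMagnetPaths hC
    exact ⟨⟨Q, p, p'⟩, (hmem _).2 ⟨hQ, hp⟩, hpC⟩

end MagnetBar

/-! ### Hyperfactorial evaluations over intervals. -/

theorem prod_Ico_eq_prod_range (z : ℤ) (n : ℕ) (f : ℤ → ℚ) :
    ∏ i ∈ Ico z (z + n), f i = ∏ j ∈ range n, f (z + j) := by
  rw [image_Ico_eq, prod_image (strictMono_add_fin z n).injective.injOn,
    Fin.prod_univ_eq_prod_range (fun j => f (z + j)) n]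

theorem hyperfactorial_ne_zero (n : ℕ) : (hyperfactorial n : ℚ) ≠ 0 := by
  rw [hyperfactorial]
  exact_mod_cast prod_ne_zero_iff.2 fun k _ => Nat.factorial_ne_zero k

theorem prod_range_factorial_add (h n : ℕ) :
    ∏ j ∈ range n, ((h + j).factorial : ℚ) = hyperfactorial (h + n) / hyperfactorial h := by
  rw [eq_div_iff (hyperfactorial_ne_zero h), hyperfactorial, hyperfactorial, prod_range_add]
  push_cast
  ring

theorem prod_Ico_invFactorial (h n : ℕ) :
    ∏ i ∈ Ico (h : ℤ) (h + n), invFactorial i = hyperfactorial h / hyperfactorial (h + n) := by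
  rw [prod_Ico_eq_prod_range, ← inv_div, ← prod_range_factorial_add, ← prod_inv_distrib]
  refine prod_congr rfl fun j _ => ?_
  rw [← Nat.cast_add, invFactorial_natCast]

theorem prod_Ico_invFactorial_sub (z : ℤ) (h n : ℕ) :
    ∏ i ∈ Ico z (z + n), invFactorial (z + n + h - 1 - i) =
      hyperfactorial h / hyperfactorial (h + n) := by
  rw [prod_Ico_eq_prod_range, ← inv_div, ← prod_range_factorial_add, ← prod_inv_distrib,
    ← prod_range_reflect]
  refine prod_congr rfl fun j hj => ?_
  have hj := mem_range.1 hj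
  rw [← invFactorial_natCast]
  congr 1
  omega

theorem prod_Ico_sub (z : ℤ) (n r : ℕ) :
    ∏ p ∈ Ico z (z + n), (((z + n + r : ℤ) : ℚ) - p) = (r + n).factorial / r.factorial := by
  rw [prod_Ico_eq_prod_range, eq_div_iff (by positivity)]
  induction n with
  | zero => simp
  | succ n ih =>
    rw [prod_range_succ', ← add_assoc, Nat.factorial_succ]
    have e : ∏ k ∈ range n, (((z + (n + 1 : ℕ) + r : ℤ) : ℚ) - ((z + (k + 1 : ℕ) : ℤ) : ℚ)) =
        ∏ k ∈ range n, (((z + n + r : ℤ) : ℚ) - ((z + k : ℤ) : ℚ)) := by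
      refine prod_congr rfl fun k _ => ?_
      push_cast; ring
    rw [e, Nat.cast_mul, ← ih]
    push_cast
    ring

theorem finsetVandermonde_Ico (z : ℤ) (n : ℕ) :
    finsetVandermonde (Ico z (z + n)) = hyperfactorial n := by
  induction n with
  | zero => simp [finsetVandermonde, hyperfactorial]
  | succ n ih =>
    have e : Ico z (z + (n + 1 : ℕ)) = Ico z (z + n) ∪ {z + n} := by
      ext i
      simp only [mem_Ico, mem_union, mem_singleton]
      push_cast
      omega
    have e1 : finsetVandermonde {z + (n : ℤ)} = 1 := by simp [finsetVandermonde, filter_singleton]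
    have e2 := prod_Ico_sub z n 0
    rw [e, finsetVandermonde_union, ih, e1, prod_singleton, hyperfactorial, hyperfactorial,
      prod_range_succ]
    · simp only [Nat.cast_zero, add_zero, zero_add, Nat.factorial_zero, Nat.cast_one,
        div_one] at e2
      rw [e2]
      push_cast
      ring
    · intro p hp q hq
      rw [mem_singleton.1 hq]
      exact (mem_Ico.1 hp).2

/-! ### Comparison with the hexagon. -/

/-- The number of path families between two intervals, that is, the number of lozenge tilings of a
hexagon. -/
theorem pathCount_Ico_Ico (y b x α : ℕ) :
    (pathCount (Ico 0 (y : ℤ)) (b + x + α) (Ico (x : ℤ) (x + y)) : ℚ) =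
      hyperfactorial (b + x + α + y) / hyperfactorial (b + x + α) *
      (hyperfactorial x / hyperfactorial (x + y)) *
      (hyperfactorial (b + α) / hyperfactorial (b + α + y)) * hyperfactorial y := by
  rw [pathCount_Ico_left (by simp), prod_range_factorial_add, prod_mul_distrib,
    prod_Ico_invFactorial, finsetVandermonde_Ico, ← prod_Ico_invFactorial_sub x (b + α) y]
  have e : ∀ i : ℤ, ((b + x + α : ℕ) : ℤ) + y - 1 - i = x + y + ((b + α : ℕ) : ℤ) - 1 - i := by
    intro i; push_cast; ring
  simp only [e]
  ring

/-- Splits off everything that depends only on the block `[m, m + c)`. What remains for each `r` is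
a weight containing its distances to that block. `pathCount_upper` does the same with `[0, m)`. -/
theorem pathCount_lower {y b c m : ℕ} {P : Finset ℤ} (hP : #P = y) (hP0 : ∀ r ∈ P, 0 ≤ r) :
    (pathCount (Ico 0 ((y + c : ℕ) : ℤ)) (b + m)
        (Ico (m : ℤ) (m + c) ∪ P.image (· + (m + c : ℤ))) : ℚ) =
      hyperfactorial (b + m + (y + c)) / hyperfactorial (b + m) *
      (hyperfactorial m / hyperfactorial (m + c)) *
      (hyperfactorial (b + y) / hyperfactorial (b + y + c)) * hyperfactorial c *
      (∏ r ∈ P, invFactorial (r + (m + c)) * invFactorial (b + y - 1 - r) *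
        ∏ p ∈ Ico (m : ℤ) (m + c), (((r + (m + c) : ℤ) : ℚ) - p)) * finsetVandermonde P := by
  have hinj : Function.Injective (· + (m + c : ℤ)) := add_left_injective _
  have hlt : ∀ p ∈ Ico (m : ℤ) (m + c), ∀ q ∈ P.image (· + (m + c : ℤ)), p < q := by
    intro p hp q hq
    obtain ⟨r, hr, rfl⟩ := mem_image.1 hq
    have := mem_Ico.1 hp
    have := hP0 r hr
    omega
  have hd : Disjoint (Ico (m : ℤ) (m + c)) (P.image (· + (m + c : ℤ))) :=
    disjoint_left.2 fun i hi hi' => (hlt i hi i hi').false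
  rw [pathCount_Ico_left, prod_range_factorial_add, finsetVandermonde_union hlt,
    finsetVandermonde_Ico, finsetVandermonde_image_add, prod_union hd, prod_image hinj.injOn,
    prod_image hinj.injOn, prod_mul_distrib, prod_Ico_invFactorial,
    ← prod_Ico_invFactorial_sub m (b + y) c, prod_mul_distrib]
  · have e1 : ∀ i : ℤ, ((b + m : ℕ) : ℤ) + ((y + c : ℕ) : ℤ) - 1 - i =
        m + c + ((b + y : ℕ) : ℤ) - 1 - i := by
      intro i; push_cast; ring
    have e2 : ∀ r : ℤ, m + c + ((b + y : ℕ) : ℤ) - 1 - (r + (m + c)) = b + y - 1 - r := by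
      intro r; push_cast; ring
    simp only [e1, e2, prod_mul_distrib]
    ring
  · rw [card_union_of_disjoint hd, card_image_of_injective _ hinj, hP]
    simp [add_comm]

theorem pathCount_upper {x y a c m : ℕ} {P : Finset ℤ} (hP : #P = y) (hP0 : ∀ r ∈ P, 0 ≤ r) :
    (pathCount (Ico 0 (m : ℤ) ∪ P.image (· + (m + c : ℤ))) (x + c + a)
        (Ico ((x + c : ℕ) : ℤ) ((x + c : ℕ) + (y + m : ℕ))) : ℚ) =
      hyperfactorial (x + c + a + (y + m)) / hyperfactorial (x + c + a) *
      (hyperfactorial a / hyperfactorial (a + m)) *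
      (hyperfactorial (x + c + y) / hyperfactorial (x + c + y + m)) * hyperfactorial m *
      (∏ r ∈ P, invFactorial (r + (m + c) + a) * invFactorial (x + y - 1 - r) *
        ∏ p ∈ Ico (0 : ℤ) m, (((r + (m + c) : ℤ) : ℚ) - p)) * finsetVandermonde P := by
  have hinj : Function.Injective (· + (m + c : ℤ)) := add_left_injective _
  have hlt : ∀ p ∈ Ico (0 : ℤ) m, ∀ q ∈ P.image (· + (m + c : ℤ)), p < q := by
    intro p hp q hq
    obtain ⟨r, hr, rfl⟩ := mem_image.1 hq
    have := mem_Ico.1 hp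
    have := hP0 r hr
    omega
  have hd : Disjoint (Ico (0 : ℤ) m) (P.image (· + (m + c : ℤ))) :=
    disjoint_left.2 fun i hi hi' => (hlt i hi i hi').false
  have hV := finsetVandermonde_Ico 0 m
  have hI := prod_Ico_invFactorial_sub 0 (x + c + y) m
  have hJ : ∏ i ∈ Ico (0 : ℤ) m, invFactorial (i + a) =
      hyperfactorial a / hyperfactorial (a + m) := by
    have h1 := prod_Ico_eq_prod_range 0 m fun i => invFactorial (i + a)
    rw [zero_add] at h1
    rw [h1, ← prod_Ico_invFactorial, prod_Ico_eq_prod_range]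
    refine prod_congr rfl fun j _ => ?_
    congr 1
    ring
  rw [zero_add] at hV hI
  rw [pathCount_Ico_right, prod_range_factorial_add, finsetVandermonde_union hlt,
    hV, finsetVandermonde_image_add, prod_union hd, prod_image hinj.injOn,
    prod_image hinj.injOn, prod_mul_distrib, ← hI, ← hJ, prod_mul_distrib]
  · have e0 : ((x + c + a : ℕ) : ℤ) - ((x + c : ℕ) : ℤ) = a := by push_cast; ring
    have e1 : ∀ i : ℤ, ((x + c : ℕ) : ℤ) + ((y + m : ℕ) : ℤ) - 1 - i =
        m + ((x + c + y : ℕ) : ℤ) - 1 - i := by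
      intro i; push_cast; ring
    have e2 : ∀ r : ℤ, m + ((x + c + y : ℕ) : ℤ) - 1 - (r + (m + c)) = x + y - 1 - r := by
      intro r; push_cast; ring
    simp only [e0, e1, e2, prod_mul_distrib, add_right_comm _ _ (a : ℤ)]
    ring
  · rw [card_union_of_disjoint hd, card_image_of_injective _ hinj, hP]
    simp [add_comm]

/-- The quotient of the numbers of tilings of a magnet bar region and of a hexagon. -/
def magnetBarRatio (x y a b c m : ℕ) : ℚ :=
  hyperfactorial (b + m + (y + c)) / hyperfactorial (b + m) *
    (hyperfactorial m / hyperfactorial (m + c)) *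
    (hyperfactorial (b + y) / hyperfactorial (b + y + c)) * hyperfactorial c *
  (hyperfactorial (x + c + a + (y + m)) / hyperfactorial (x + c + a) *
    (hyperfactorial a / hyperfactorial (a + m)) *
    (hyperfactorial (x + c + y) / hyperfactorial (x + c + y + m)) * hyperfactorial m) /
  (hyperfactorial (b + y) / hyperfactorial b *
    (hyperfactorial (x + (a + m + c) + y) / hyperfactorial (x + (a + m + c))))

/-- The heart of the cancellation. The distances to the two blocks multiply to `(r + c)! / r!` and
`(r + c + m)! / (r + c)!`, so together they replace `1 / (r + m + c)!` by `1 / r!`, the weight for a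
hexagon without holes. -/
theorem invFactorial_magnet_weight (m c a r : ℕ) :
    invFactorial ((r : ℤ) + (m + c)) *
        (∏ p ∈ Ico (m : ℤ) (m + c), ((((r : ℤ) + (m + c) : ℤ) : ℚ) - p)) *
        (invFactorial ((r : ℤ) + (m + c) + a) *
          ∏ p ∈ Ico (0 : ℤ) m, ((((r : ℤ) + (m + c) : ℤ) : ℚ) - p)) =
      invFactorial r * invFactorial (r + (a + m + c : ℕ)) := by
  have h1 := prod_Ico_sub m c r
  have h2 := prod_Ico_sub 0 m (r + c)
  have e1 : (m : ℤ) + c + r = r + (m + c) := by ring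
  have e2 : (0 : ℤ) + m + ((r + c : ℕ) : ℤ) = r + (m + c) := by push_cast; ring
  have e3 : (r : ℤ) + (m + c) = ((r + c + m : ℕ) : ℤ) := by push_cast; ring
  have e4 : (r : ℤ) + (m + c) + a = r + (a + m + c : ℕ) := by push_cast; ring
  rw [e1] at h1
  rw [e2, zero_add] at h2
  rw [h1, h2, e4, e3, invFactorial_natCast, invFactorial_natCast]
  have hA : ((r + c + m).factorial : ℚ) ≠ 0 := by positivity
  have hB : ((r + c).factorial : ℚ) ≠ 0 := by positivity
  field_simp

theorem pathCount_lower_mul_upper (x y a b c m : ℕ) {P : Finset ℤ} (hP0 : ∀ r ∈ P, 0 ≤ r) :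
    (pathCount (Ico 0 ((y + c : ℕ) : ℤ)) (b + m)
        (Ico (m : ℤ) (m + c) ∪ P.image (· + (m + c : ℤ))) : ℚ) *
      pathCount (Ico 0 (m : ℤ) ∪ P.image (· + (m + c : ℤ))) (x + c + a)
        (Ico ((x + c : ℕ) : ℤ) ((x + c : ℕ) + (y + m : ℕ))) =
    magnetBarRatio x y a b c m * (pathCount (Ico 0 (y : ℤ)) b P *
      pathCount P (x + (a + m + c)) (Ico (x : ℤ) (x + y))) := by
  -- Steps preserve the number of paths, so for any other cardinality both sides vanish.
  by_cases hP : #P = y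
  · rw [pathCount_lower hP hP0, pathCount_upper hP hP0, pathCount_Ico_left hP,
      pathCount_Ico_right hP, prod_range_factorial_add, prod_range_factorial_add, magnetBarRatio]
    -- The weights agree position by position. Both sides also carry the square of the same
    -- Vandermonde product, so only constants differ.
    have hw : (∏ r ∈ P, invFactorial (r + (m + c)) * invFactorial (b + y - 1 - r) *
          ∏ p ∈ Ico (m : ℤ) (m + c), (((r + (m + c) : ℤ) : ℚ) - p)) *
        (∏ r ∈ P, invFactorial (r + (m + c) + a) * invFactorial (x + y - 1 - r) *
          ∏ p ∈ Ico (0 : ℤ) m, (((r + (m + c) : ℤ) : ℚ) - p)) =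
        (∏ r ∈ P, invFactorial r * invFactorial (b + y - 1 - r)) *
        ∏ r ∈ P, invFactorial (r + (((x + (a + m + c) : ℕ) : ℤ) - x)) *
          invFactorial (x + y - 1 - r) := by
      rw [← prod_mul_distrib, ← prod_mul_distrib]
      refine prod_congr rfl fun r hr => ?_
      obtain ⟨r, rfl⟩ := Int.eq_ofNat_of_zero_le (hP0 r hr)
      have := invFactorial_magnet_weight m c a r
      have e : ((x + (a + m + c) : ℕ) : ℤ) - x = ((a + m + c : ℕ) : ℤ) := by push_cast; ring
      rw [e]
      linear_combination
        (invFactorial (b + y - 1 - r) * invFactorial (x + y - 1 - r)) * this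
    have h1 := hyperfactorial_ne_zero (b + y)
    have h2 := hyperfactorial_ne_zero b
    have h3 := hyperfactorial_ne_zero (x + (a + m + c) + y)
    have h4 := hyperfactorial_ne_zero (x + (a + m + c))
    generalize (∏ r ∈ P, invFactorial (r + (m + c)) * invFactorial (b + y - 1 - r) *
      ∏ p ∈ Ico (m : ℤ) (m + c), (((r + (m + c) : ℤ) : ℚ) - p)) = W₁ at hw ⊢
    generalize (∏ r ∈ P, invFactorial (r + (m + c) + a) * invFactorial (x + y - 1 - r) *
      ∏ p ∈ Ico (0 : ℤ) m, (((r + (m + c) : ℤ) : ℚ) - p)) = W₂ at hw ⊢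
    generalize (∏ r ∈ P, invFactorial r * invFactorial (b + y - 1 - r)) = U₁ at hw ⊢
    generalize (∏ r ∈ P, invFactorial (r + (((x + (a + m + c) : ℕ) : ℤ) - x)) *
      invFactorial (x + y - 1 - r)) = U₂ at hw ⊢
    generalize (hyperfactorial (b + m + (y + c)) : ℚ) / hyperfactorial (b + m) *
      (hyperfactorial m / hyperfactorial (m + c)) *
      (hyperfactorial (b + y) / hyperfactorial (b + y + c)) * hyperfactorial c = K₁
    generalize (hyperfactorial (x + c + a + (y + m)) : ℚ) / hyperfactorial (x + c + a) *
      (hyperfactorial a / hyperfactorial (a + m)) *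
      (hyperfactorial (x + c + y) / hyperfactorial (x + c + y + m)) * hyperfactorial m = K₂
    have hD : (hyperfactorial (b + y) : ℚ) / hyperfactorial b *
      (hyperfactorial (x + (a + m + c) + y) / hyperfactorial (x + (a + m + c))) ≠ 0 :=
      mul_ne_zero (div_ne_zero h1 h2) (div_ne_zero h3 h4)
    rw [div_mul_eq_mul_div, eq_div_iff hD]
    linear_combination (K₁ * K₂ * finsetVandermonde P ^ 2 *
      ((hyperfactorial (b + y) : ℚ) / hyperfactorial b *
      (hyperfactorial (x + (a + m + c) + y) / hyperfactorial (x + (a + m + c))))) * hw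
  · have hinj : Function.Injective (· + (m + c : ℤ)) := add_left_injective _
    have hd : Disjoint (Ico (m : ℤ) (m + c)) (P.image (· + (m + c : ℤ))) := by
      refine disjoint_left.2 fun i hi hi' => ?_
      obtain ⟨r, hr, rfl⟩ := mem_image.1 hi'
      have := mem_Ico.1 hi
      have := hP0 r hr
      omega
    have h1 : pathCount (Ico 0 ((y + c : ℕ) : ℤ)) (b + m)
        (Ico (m : ℤ) (m + c) ∪ P.image (· + (m + c : ℤ))) = 0 := by
      by_contra hne
      have := card_eq_of_pathCount_ne_zero hne
      rw [card_union_of_disjoint hd, card_image_of_injective _ hinj, Int.card_Ico,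
        Int.card_Ico] at this
      omega
    have h2 : pathCount (Ico 0 (y : ℤ)) b P = 0 := by
      by_contra hne
      have := card_eq_of_pathCount_ne_zero hne
      rw [Int.card_Ico] at this
      omega
    rw [h1, h2]
    simp

theorem numLozengeTilings_magnetBarRegion (x y a b c m : ℕ) :
    (numLozengeTilings (magnetBarRegion x y a b c m) : ℚ) = magnetBarRatio x y a b c m *
      pathCount (Ico 0 (y : ℤ)) (b + x + (a + m + c)) (Ico (x : ℤ) (x + y)) := by
  -- The hexagon is cut after `b` steps. Its paths then lie in `[0, y + b)`, the range of `Q`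
  -- translated by `-(m + c)`, so the two sums match term by term.
  have hCK := pathCount_add (Ico 0 (y : ℤ)) (Ico (x : ℤ) (x + y)) b (x + (a + m + c))
    (Ico 0 (y + b : ℤ)).powerset fun Q' hQ' =>
      mem_powerset.2 (subset_Ico_of_pathCount_ne_zero hQ' subset_rfl)
  rw [add_assoc b x, hCK, numLozengeTilings_magnetBarRegion_eq_sum]
  push_cast
  rw [mul_sum]
  symm
  have hinj : Function.Injective (· + (m + c : ℤ)) := add_left_injective _
  refine sum_nbij (fun P => P.image (· + (m + c : ℤ))) ?_ ?_ ?_ ?_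
  · intro P hP
    rw [mem_powerset] at hP ⊢
    intro i hi
    obtain ⟨r, hr, rfl⟩ := mem_image.1 hi
    have := mem_Ico.1 (hP hr)
    rw [mem_Ico]
    omega
  · exact (image_injective hinj).injOn
  · intro Q hQ
    have hQ := mem_powerset.1 (mem_coe.1 hQ)
    refine ⟨Q.image (· - (m + c : ℤ)), ?_, ?_⟩
    · rw [mem_coe, mem_powerset]
      intro i hi
      obtain ⟨q, hq, rfl⟩ := mem_image.1 hi
      have := mem_Ico.1 (hQ hq)
      rw [mem_Ico]
      omega
    · dsimp only
      rw [image_image]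
      simp [Function.comp_def]
  · intro P hP
    have hP := mem_powerset.1 hP
    have := pathCount_lower_mul_upper x y a b c m fun r hr => (mem_Ico.1 (hP hr)).1
    push_cast at this
    exact this.symm

theorem theorem3p1 (x y a b c m : ℕ) :
    (numLozengeTilings (magnetBarRegion x y a b c m) : ℚ) =
      ((hyperfactorial m : ℚ) ^ 2 * hyperfactorial a * hyperfactorial b * hyperfactorial c *
          hyperfactorial (m + a + b + c)) /
        (hyperfactorial (m + a) * hyperfactorial (m + b) * hyperfactorial (m + c)) *
      ((hyperfactorial (x + m + a + c) * hyperfactorial (y + m + b + c)) /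
        hyperfactorial (x + y + m + c)) *
      (hyperfactorial (x + y + c) /
        (hyperfactorial (x + a + c) * hyperfactorial (y + b + c))) *
      (hyperfactorial (x + y + m + a + b + c) /
        (hyperfactorial (x + m + a + b + c) * hyperfactorial (y + m + a + b + c))) *
      ((hyperfactorial x * hyperfactorial y) / hyperfactorial (x + y)) := by
  rw [numLozengeTilings_magnetBarRegion, pathCount_Ico_Ico, magnetBarRatio,
    show b + m + (y + c) = y + m + b + c by ring, show b + m = m + b by ring,
    show b + y + c = y + b + c by ring, show x + c + a + (y + m) = x + (a + m + c) + y by ring,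
    show x + c + a = x + a + c by ring, show a + m = m + a by ring,
    show x + c + y + m = x + y + m + c by ring, show x + c + y = x + y + c by ring,
    show b + x + (m + a + c) + y = x + y + m + a + b + c by ring,
    show b + x + (m + a + c) = x + m + a + b + c by ring,
    show b + (m + a + c) + y = y + m + a + b + c by ring,
    show b + (m + a + c) = m + a + b + c by ring, show x + (m + a + c) = x + m + a + c by ring]
  -- Two hyperfactorials occur both as factors and as inverses without cancelling under `ring`. The
  -- same pairs, each equal to 1, are inserted on the right.
  have key : ∀ z : ℚ, (hyperfactorial (b + y) * (hyperfactorial (b + y) : ℚ)⁻¹) *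
      (hyperfactorial (x + m + a + c + y) * (hyperfactorial (x + m + a + c + y) : ℚ)⁻¹) * z = z := by
    intro z
    rw [mul_inv_cancel₀ (hyperfactorial_ne_zero _), mul_inv_cancel₀ (hyperfactorial_ne_zero _),
      one_mul, one_mul]
  refine Eq.trans ?_ (key _)
  simp only [div_eq_mul_inv, mul_inv, inv_inv]
  ring
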